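/- Consider the class $\mathscr F$ of $(1+1)$-dimensional equations $$i\psi_t+\psi_{xx}+F(t,x,\psi,\psi^*,\psi_x,\psi_x^*)=0$$ for a complex-valued function $\psi$ of two real variables $t,x$, where the arbitrary element $F$ is a smooth complex-valued function on an open set of the space of $(t,x,\psi,\psi_x)\in\mathbb R^2\times\mathbb C^2$ (smoothness in $\psi$, $\psi_x$ is real smoothness, equivalently smoothness in $\psi,\psi^*,\psi_x,\psi_x^*$). Each equation is identified with the submanifold of the second-order jet space that it defines. All transformations are local. A *point transformation* is a smooth diffeomorphism between two open subsets of the space under consideration. An *admissible transformation* from the equation with $F$ into the equation with $\tilde F$ is a point transformation $\varphi$ of $(t,x,\psi)$, with source and target lying in the regions over which $F$ and $\tilde F$ are defined, whose second prolongation maps the first equation onto the second one (a jet over the source at which the prolongation is defined lies on the first equation if and only if its image lies on the second). The admissible transformations from an equation into itself are its *point symmetries*. The (usual) *equivalence group* $G^\sim_{\mathscr F}$ is the (pseudo)group of the point transformations $\Psi$ of the space of $t$, $x$, $\psi$, the first- and second-order derivatives of $\psi$, and $F$ such that $\Psi$ projects to a point transformation $\varphi=\Psi|_{(t,x,\psi)}$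 of $(t,x,\psi)$, acts on the derivatives as the second prolongation of $\varphi$ (being defined for all jets over the source of $\varphi$ at which this prolongation is defined and for all values of $F$), and maps every arbitrary element $F$ defined over the source of $\varphi$ to an arbitrary element $\Psi F$ such that $\varphi$ is admissible from the equation with $F$ into the equation with $\Psi F$; here $\Psi$ maps the graph of $F$ to the graph of $\Psi F$. **Theorem.** 1. The class $\mathscr F$ is strongly normalized. That is, it is normalized: for each admissible transformation $\varphi$ from the equation with $F$ into the equation with $\tilde F$ there is $\Psi\in G^\sim_{\mathscr F}$ such that $\varphi=\Psi|_{(t,x,\psi)}$ and $\tilde F=\Psi F$ (over the target of $\varphi$). Moreover, the set $\{\Psi|_{(t,x,\psi)}\mid\Psi\in G^\sim_{\mathscr F}\}$ is the pseudogroup generated by the point symmetries of all equations of the class. 2. The equivalence group $G^\sim_{\mathscr F}$ is formed by the transformations $$\tilde t=T(t),\qquad \tilde x=\varepsilon x|T_t|^{1/2}+X(t),\qquad \tilde\psi=\Phi(t,x,\hat\psi),$$ $$\tilde F=\frac1{|T_t|}\Bigl(\Phi_{\hat\psi}\hat F-i\varepsilon'\Phi_t+i\Bigl(\frac{T_{tt}}{2|T_t|}x+\frac{\varepsilon\varepsilon'X_t}{|T_t|^{1/2}}\Bigr)(\Phi_x+\Phi_{\hat\psi}\hat\psi_x)-\Phi_{xx}-2\Phi_{x\hat\psi}\hat\psi_x-\Phi_{\hat\psi\hat\psi}(\hat\psi_x)^2\Bigr),$$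 where $T$ and $X$ are arbitrary smooth real-valued functions of $t$ with $T_t\ne0$, $\varepsilon=\pm1$, $\varepsilon'=\operatorname{sign}T_t$, $\hat\beta=\beta$ if $T_t>0$ and $\hat\beta=\beta^*$ if $T_t<0$ for a complex value $\beta$, and $\Phi$ is an arbitrary smooth complex-valued function of $t$, $x$ and $\hat\psi$ (independent of $\hat\psi^*$, i.e. holomorphic in $\hat\psi$) with $\Phi_{\hat\psi}\ne0$. In detail: (a) a point transformation $\Psi$ of the space of $t$, $x$, $\psi$, the derivatives and $F$ that is defined as above and acts on the jets as the second prolongation of a point transformation $\varphi$ of $(t,x,\psi)$ belongs to $G^\sim_{\mathscr F}$ if and only if over every convex open subset of the source of $\varphi$ it has this form for some $T$, $X$, $\varepsilon$, $\Phi$; (b) for all such $T$, $X$, $\varepsilon$, $\Phi$ given over an open set $N$ of the space of $(t,x,\psi)$, each point of $N$ lies in the source, contained in $N$, of the restriction to $(t,x,\psi)$ of an element of $G^\sim_{\mathscr F}$ that has this form there. -/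

import Mathlib

open Set Filter Topology
open scoped ContDiff

noncomputable section

namespace SchrodingerClass

/-! ### Spaces of variables -/

/-- The space of the variables `((t, x), ψ)`.  A function of `ψ` and `ψ*` is a function of `ψ ∈ ℂ`
regarded as a real plane, so smoothness is always real smoothness here. -/
abbrev Base : Type := (ℝ × ℝ) × ℂ

/-- The space of the arguments `(((t, x), ψ), ψ_x)` of the arbitrary element `F`. -/
abbrev ArgSpace : Type := Base × ℂ

/-- The second-order jet space, with coordinates
`(((t, x), ψ), (ψ_t, ψ_x), (ψ_tt, ψ_tx, ψ_xx))`. -/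
abbrev Jet : Type := Base × (ℂ × ℂ) × (ℂ × ℂ × ℂ)

/-- The arguments of the arbitrary element at a jet. -/
def Jet.args (j : Jet) : ArgSpace := (j.1, j.2.1.2)

/-- The partial derivative of `u(t, x)` with respect to `t`. -/
def partialT (u : ℝ × ℝ → ℂ) (p : ℝ × ℝ) : ℂ := deriv (fun s : ℝ => u (s, p.2)) p.1

/-- The partial derivative of `u(t, x)` with respect to `x`. -/
def partialX (u : ℝ × ℝ → ℂ) (p : ℝ × ℝ) : ℂ := deriv (fun y : ℝ => u (p.1, y)) p.2

/-- The second-order jet of the function `u` at the point `p`. -/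
def jetOf (u : ℝ × ℝ → ℂ) (p : ℝ × ℝ) : Jet :=
  ((p, u p), (partialT u p, partialX u p),
    (partialT (partialT u) p, partialT (partialX u) p, partialX (partialX u) p))

/-! ### The class of equations -/

/-- An arbitrary element of the class: a smooth complex-valued function `F` of
`(t, x, ψ, ψ*, ψ_x, ψ*_x)` on an open set. -/
structure ArbitraryElement where
  dom : Set ArgSpace
  isOpen_dom : IsOpen dom
  toFun : ArgSpace → ℂ
  smooth : ContDiffOn ℝ ∞ toFun dom

/-- The region of the space of `(t, x, ψ)` over which `F` is defined. -/
def ArbitraryElement.region (F : ArbitraryElement) : Set Base := Prod.fst '' F.dom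

/-- The equation `i ψ_t + ψ_xx + F = 0`, as a submanifold of the second-order jet space. -/
def ArbitraryElement.equation (F : ArbitraryElement) : Set Jet :=
  {j | j.args ∈ F.dom ∧ Complex.I * j.2.1.1 + j.2.2.2.2 + F.toFun j.args = 0}

/-- The graph of `F`, as a differential function of order two, in the space of
`(t, x, ψ_(2), F)`. -/
def ArbitraryElement.graph (F : ArbitraryElement) : Set (Jet × ℂ) :=
  {q | q.1.args ∈ F.dom ∧ q.2 = F.toFun q.1.args}

/-! ### Point transformations and their prolongation -/

/-- A (locally defined) point transformation: a smooth diffeomorphism of an open set `e.source`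
onto an open set `e.target`. -/
def IsPointTransformation {E : Type*} [NormedAddCommGroup E] [NormedSpace ℝ E]
    (e : OpenPartialHomeomorph E E) : Prop :=
  ContDiffOn ℝ ∞ e e.source ∧ ContDiffOn ℝ ∞ e.symm e.target

/-- The graph of the second prolongation of `φ`: `j` is the jet at `p` of a function `u`, `j'` is
the jet at `p'` of a function `v`, and `φ` maps the graph of `u` near `p` into the graph of `v`,
and the point over `p` to the point over `p'`. -/
def Prolongs (φ : OpenPartialHomeomorph Base Base) (j j' : Jet) : Prop :=
  ∃ (u v : ℝ × ℝ → ℂ) (p p' : ℝ × ℝ),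
    ContDiffAt ℝ ∞ u p ∧ ContDiffAt ℝ ∞ v p' ∧
    jetOf u p = j ∧ jetOf v p' = j' ∧
    (p, u p) ∈ φ.source ∧ φ (p, u p) = (p', v p') ∧
    ∀ᶠ q in 𝓝 p, v (φ (q, u q)).1 = (φ (q, u q)).2

/-- The set `T(F, F')` of admissible transformations from the equation with `F` into the equation
with `F'`: the second prolongation maps the first manifold into the second, and only it. -/
def admissible (F F' : ArbitraryElement) : Set (OpenPartialHomeomorph Base Base) :=
  {φ | IsPointTransformation φ ∧ φ.source ⊆ F.region ∧ φ.target ⊆ F'.region ∧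
    ∀ j j', Prolongs φ j j' → (j ∈ F.equation ↔ j' ∈ F'.equation)}

/-- The point symmetry pseudogroup of the equation with the arbitrary element `F`. -/
def symmetries (F : ArbitraryElement) : Set (OpenPartialHomeomorph Base Base) :=
  admissible F F

/-! ### The equivalence group -/

/-- The transformation `Ψ` of `(t, x, ψ_(2), F)` is projectable, its restriction to `(t, x, ψ)` is
`φ` and its restriction to the jet variables is the second prolongation of `φ` (so that its
restriction to the variables of order at most one is the first prolongation).  It is defined
wherever the prolongation is, for all values of the variable `F`. -/
def RestrictsTo (Ψ : OpenPartialHomeomorph (Jet × ℂ) (Jet × ℂ))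
    (φ : OpenPartialHomeomorph Base Base) : Prop :=
  Ψ.source = {q | ∃ j', Prolongs φ q.1 j'} ∧
  Ψ.target = {q | ∃ j, Prolongs φ j q.1} ∧
  ∀ q ∈ Ψ.source, Prolongs φ q.1 (Ψ q).1

/-- `F' = Ψ F`: the transformation `Ψ` maps the graph of `F` (over its domain of definition) onto
the graph of `F'` (over its range). -/
def IsImage (Ψ : OpenPartialHomeomorph (Jet × ℂ) (Jet × ℂ)) (F F' : ArbitraryElement) : Prop :=
  ∀ q ∈ Ψ.source, q ∈ F.graph ↔ Ψ q ∈ F'.graph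

/-- `Ψ` is an element of the usual equivalence group of the class, and `φ` is its restriction to
the space of `(t, x, ψ)`. -/
def IsEquivalenceTransformation (Ψ : OpenPartialHomeomorph (Jet × ℂ) (Jet × ℂ))
    (φ : OpenPartialHomeomorph Base Base) : Prop :=
  IsPointTransformation Ψ ∧ IsPointTransformation φ ∧ RestrictsTo Ψ φ ∧
  ∀ F : ArbitraryElement, φ.source ⊆ F.region →
    ∃ F' : ArbitraryElement, IsImage Ψ F F' ∧ φ ∈ admissible F F'

/-- The restriction of the equivalence group to the space of `(t, x, ψ)`. -/
def equivalenceGroupOnBase : Set (OpenPartialHomeomorph Base Base) :=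
  {φ | ∃ Ψ, IsEquivalenceTransformation Ψ φ}

/-! ### Normalization -/

/-- The class is normalized: every admissible transformation is induced by a transformation from
the equivalence group. -/
def IsNormalized : Prop :=
  ∀ (F F' : ArbitraryElement), ∀ φ ∈ admissible F F',
    ∃ Ψ, IsEquivalenceTransformation Ψ φ ∧ IsImage Ψ F F'

/-- The pseudogroup of local homeomorphisms generated by a set of such homeomorphisms. -/
def generatedPseudogroup (S : Set (OpenPartialHomeomorph Base Base)) : StructureGroupoid Base :=
  sInf {G | S ⊆ G.members}

/-- The class is strongly normalized: it is normalized and the restriction of the equivalence group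
to `(t, x, ψ)` is generated by the point symmetries of the equations of the class. -/
def IsStronglyNormalized : Prop :=
  IsNormalized ∧
    equivalenceGroupOnBase =
      (generatedPseudogroup (⋃ F : ArbitraryElement, symmetries F)).members

/-! ### The explicit transformations -/

/-- `β` if `ε' > 0`, and its complex conjugate otherwise. -/
def hat (ε' : ℝ) (β : ℂ) : ℂ := if 0 < ε' then β else (starRingEnd ℂ) β

/-- The set of the points `(t, x, w)` with `w` the hatted value of `ψ` for some `(t, x, ψ) ∈ N`. -/
def hatSet (ε' : ℝ) (N : Set Base) : Set Base := {y | (y.1, hat ε' y.2) ∈ N}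

/-- Parameters of the explicit transformations over a set `N` in the space of `(t, x, ψ)`: the
functions `T`, `X` of `t` and `Φ` of `(t, x, w)`, where `w` is the hatted `ψ`, and signs `ε` and
`ε' = sign T_t`.  That `Φ` depends on `w` alone and not on its conjugate means that it is
holomorphic in `w`. -/
structure IsParameterSystem (N : Set Base) (T X : ℝ → ℝ) (ε ε' : ℝ) (Φ : ℝ → ℝ → ℂ → ℂ) :
    Prop where
  eps : ε = 1 ∨ ε = -1
  eps' : ε' = 1 ∨ ε' = -1
  smooth_T : ContDiffOn ℝ ∞ T ((fun z : Base => z.1.1) '' N)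
  smooth_X : ContDiffOn ℝ ∞ X ((fun z : Base => z.1.1) '' N)
  sign_T : ∀ z ∈ N, 0 < ε' * deriv T z.1.1
  smooth_Φ : ContDiffOn ℝ ∞ (fun y : Base => Φ y.1.1 y.1.2 y.2) (hatSet ε' N)
  holomorphic : ∀ y ∈ hatSet ε' N, DifferentiableAt ℂ (Φ y.1.1 y.1.2) y.2
  deriv_ne_zero : ∀ y ∈ hatSet ε' N, deriv (Φ y.1.1 y.1.2) y.2 ≠ 0

/-- The right-hand sides of the formulas for the new `t`, `x` and `ψ`. -/
def newBase (T X : ℝ → ℝ) (ε ε' : ℝ) (Φ : ℝ → ℝ → ℂ → ℂ) (z : Base) : Base :=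
  ((T z.1.1, ε * z.1.2 * Real.sqrt |deriv T z.1.1| + X z.1.1), Φ z.1.1 z.1.2 (hat ε' z.2))

/-- The right-hand side of the formula for the new `F`, at a jet `j` and a value `f` of `F`. -/
def newF (T X : ℝ → ℝ) (ε ε' : ℝ) (Φ : ℝ → ℝ → ℂ → ℂ) (j : Jet) (f : ℂ) : ℂ :=
  let t : ℝ := j.1.1.1
  let x : ℝ := j.1.1.2
  let w : ℂ := hat ε' j.1.2
  let wx : ℂ := hat ε' j.2.1.2
  let Tt : ℝ := deriv T t
  let Ttt : ℝ := deriv (deriv T) t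
  let Xt : ℝ := deriv X t
  let Φt : ℂ := deriv (fun s : ℝ => Φ s x w) t
  let Φx : ℂ := deriv (fun y : ℝ => Φ t y w) x
  let Φw : ℂ := deriv (Φ t x) w
  let Φxx : ℂ := deriv (fun y : ℝ => deriv (fun y' : ℝ => Φ t y' w) y) x
  let Φxw : ℂ := deriv (fun y : ℝ => deriv (Φ t y) w) x
  let Φww : ℂ := deriv (deriv (Φ t x)) w
  ((1 / |Tt| : ℝ) : ℂ) *
    (Φw * hat ε' f - Complex.I * (ε' : ℂ) * Φt
      + Complex.I * ((Ttt / (2 * |Tt|) * x + ε * ε' * Xt / Real.sqrt |Tt| : ℝ) : ℂ)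
          * (Φx + Φw * wx)
      - Φxx - 2 * Φxw * wx - Φww * wx ^ 2)

/-- Over the set `N`, the transformation `Ψ` with the restriction `φ` to `(t, x, ψ)` is given by
the explicit formulas with the parameters `T`, `X`, `ε`, `ε'`, `Φ`. -/
def IsGivenBy (Ψ : OpenPartialHomeomorph (Jet × ℂ) (Jet × ℂ))
    (φ : OpenPartialHomeomorph Base Base) (N : Set Base)
    (T X : ℝ → ℝ) (ε ε' : ℝ) (Φ : ℝ → ℝ → ℂ → ℂ) : Prop :=
  (∀ z ∈ N, φ z = newBase T X ε ε' Φ z) ∧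
  ∀ q ∈ Ψ.source, q.1.1 ∈ N → (Ψ q).2 = newF T X ε ε' Φ q.1 q.2

end SchrodingerClass

end

/-! A prolongation is governed by the differential of `φ` on tangent planes of graphs
(`Prolongs.slope_eq`) and by its second-order analogue (`Prolongs.curv_eq`). The equations fix one
combination of jet variables and leave the other derivatives free, so varying the free ones
constrains the differential of `φ`.

Two jets on the equation that differ only in `ψ_tt` must have images with the same second
`x`-derivative. Hence the direction that `φ` sends to the new `∂_x` has no `t`-component, and the
new `t` depends on `t` alone (`admissible_time`). Next, vary `ψ_t` with `ψ_x` fixed and compensate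
in `ψ_xx`. With `τ` the derivative of the new `t`, `c` the total `x`-derivative of the new `x` and
`B` the induced real-linear map on fibres, the target equation gives `c² i B(ζ) = τ B(iζ)`
(`admissible_scale`). Applied twice, this yields `c² = |τ|`, and then `B` is complex linear or
antilinear according to the sign of `τ`. As `c` is affine in `ψ_x` and satisfies a polynomial
equation with constant coefficients on an open set, the new `x` does not depend on `ψ`. These
pointwise conditions are `IsReduced`, and `admissible_isReduced` derives them from admissibility.

Conversely, for a transformation with reduced differentials, at fixed arguments of `F` the
differences of `i ψ_t + ψ_xx` are transformed by an invertible real-linear map (`principal_sub`).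
Every `F` over the source therefore has an image, so the transformation is the base part of an
element of the equivalence group. The conditions do not involve `F`, and this is normalization.

For strong normalization, a reduced transformation with disjoint source and target is a symmetry of
the equation whose `F` is `0` over the source and the image of `0` over the target
(`mem_symmetries`). Near a point that is not fixed, shrinking makes source and target disjoint; near
a fixed point the transformation is composed with a time shift and its inverse.

The explicit formulas come from integrating the reduced conditions over a convex set
(`exists_parameters`), and the formula for the new `F` is the chain rule written out (`newF_eq`).
The inverse function theorem realizes all parameters locally. -/

noncomputable section

namespace SchrodingerClass

/-! ### Second derivatives and jets -/

section Calculus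

variable {E G H : Type*} [NormedAddCommGroup E] [NormedSpace ℝ E] [NormedAddCommGroup G]
  [NormedSpace ℝ G] [NormedAddCommGroup H] [NormedSpace ℝ H]

theorem eventually_differentiableAt {f : E → G} {x : E} (hf : ContDiffAt ℝ 2 f x) :
    ∀ᶠ y in 𝓝 x, DifferentiableAt ℝ f y := by
  filter_upwards [hf.eventually (by simp)] with y hy
  exact hy.differentiableAt (by simp)

theorem differentiableAt_fderiv {f : E → G} {x : E} (hf : ContDiffAt ℝ 2 f x) :
    DifferentiableAt ℝ (fderiv ℝ f) x :=
  (hf.fderiv_right (m := 1) (by norm_num)).differentiableAt (by simp)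

theorem fderiv_fderiv_comp {g : G → H} {f : E → G} {x : E} (hg : ContDiffAt ℝ 2 g (f x))
    (hf : ContDiffAt ℝ 2 f x) (v w : E) :
    fderiv ℝ (fderiv ℝ (fun y => g (f y))) x v w =
      fderiv ℝ (fderiv ℝ g) (f x) (fderiv ℝ f x v) (fderiv ℝ f x w) +
        fderiv ℝ g (f x) (fderiv ℝ (fderiv ℝ f) x v w) := by
  have hfd : DifferentiableAt ℝ f x := hf.differentiableAt (by simp)
  have h1 : fderiv ℝ (fun y => g (f y)) =ᶠ[𝓝 x]
      fun y => (fderiv ℝ g (f y)).comp (fderiv ℝ f y) := by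
    filter_upwards [eventually_differentiableAt hf,
      hfd.continuousAt.eventually (eventually_differentiableAt hg)] with y hy hy'
    exact fderiv_comp y hy' hy
  rw [h1.fderiv_eq]
  have h2 : HasFDerivAt (fun y => fderiv ℝ g (f y))
      ((fderiv ℝ (fderiv ℝ g) (f x)).comp (fderiv ℝ f x)) x :=
    (differentiableAt_fderiv hg).hasFDerivAt.comp x hfd.hasFDerivAt
  have h3 := h2.clm_comp (differentiableAt_fderiv hf).hasFDerivAt
  rw [h3.fderiv]
  simp [add_comm]

theorem fderiv_fderiv_apply {f : E → G} {x : E} (hf : ContDiffAt ℝ 2 f x) (v w : E) :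
    fderiv ℝ (fun y => fderiv ℝ f y w) x v = fderiv ℝ (fderiv ℝ f) x v w := by
  have := (differentiableAt_fderiv hf).hasFDerivAt.clm_apply (hasFDerivAt_const w x)
  rw [this.fderiv]
  simp

theorem fderiv_fderiv_symm {f : E → G} {x : E} (hf : ContDiffAt ℝ 2 f x) (v w : E) :
    fderiv ℝ (fderiv ℝ f) x v w = fderiv ℝ (fderiv ℝ f) x w v :=
  (hf.isSymmSndFDerivAt (by simp)) v w

theorem fderiv_fderiv_clm_comp {f : E → G} {x : E} (L : G →L[ℝ] H) (hf : ContDiffAt ℝ 2 f x)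
    (v w : E) :
    fderiv ℝ (fderiv ℝ (fun y => L (f y))) x v w = L (fderiv ℝ (fderiv ℝ f) x v w) := by
  have e : fderiv ℝ (L : G → H) = fun _ => L := by ext1 y; exact L.fderiv
  have h := fderiv_fderiv_comp (g := L) L.contDiff.contDiffAt hf v w
  simpa [e] using h

theorem fderiv_graph {u : E → G} {p : E} (hu : DifferentiableAt ℝ u p) (v : E) :
    fderiv ℝ (fun q => (q, u q)) p v = (v, fderiv ℝ u p v) := by
  have h : HasFDerivAt (fun q => (q, u q)) _ p := (hasFDerivAt_id p).prodMk hu.hasFDerivAt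
  rw [h.fderiv]
  simp

theorem fderiv_fderiv_graph {u : E → G} {p : E} (hu : ContDiffAt ℝ 2 u p) (v w : E) :
    fderiv ℝ (fderiv ℝ (fun q => (q, u q))) p v w = (0, fderiv ℝ (fderiv ℝ u) p v w) := by
  have h : ContDiffAt ℝ 2 (fun q => (q, u q)) p := contDiffAt_id.prodMk hu
  have h1 := fderiv_fderiv_clm_comp (ContinuousLinearMap.fst ℝ E G) h v w
  have h2 := fderiv_fderiv_clm_comp (ContinuousLinearMap.snd ℝ E G) h v w
  have e3 : fderiv ℝ (fun q : E => q) = fun _ => ContinuousLinearMap.id ℝ E := by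
    ext1 y; exact fderiv_id
  refine Prod.ext ?_ ?_
  · simpa [e3] using h1.symm
  · simpa using h2.symm

theorem fderiv_comp_graph {u : E → G} {p : E} {h : E × G → H} (hu : DifferentiableAt ℝ u p)
    (hh : DifferentiableAt ℝ h (p, u p)) (v : E) :
    fderiv ℝ (fun q => h (q, u q)) p v = fderiv ℝ h (p, u p) (v, fderiv ℝ u p v) := by
  have := fderiv_comp (f := fun q => (q, u q)) (g := h) p hh
    (differentiableAt_id.prodMk hu)
  rw [show (fun q => h (q, u q)) = h ∘ (fun q => (q, u q)) from rfl, this,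
    ContinuousLinearMap.comp_apply, fderiv_graph hu]

theorem fderiv_fderiv_comp_graph {u : E → G} {p : E} {h : E × G → H} (hu : ContDiffAt ℝ 2 u p)
    (hh : ContDiffAt ℝ 2 h (p, u p)) (v w : E) :
    fderiv ℝ (fderiv ℝ (fun q => h (q, u q))) p v w =
      fderiv ℝ (fderiv ℝ h) (p, u p) (v, fderiv ℝ u p v) (w, fderiv ℝ u p w) +
        fderiv ℝ h (p, u p) (0, fderiv ℝ (fderiv ℝ u) p v w) := by
  have hd : DifferentiableAt ℝ u p := hu.differentiableAt (by simp)
  have := fderiv_fderiv_comp (g := h) (f := fun q => (q, u q)) hh (contDiffAt_id.prodMk hu) v w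
  rw [this, fderiv_fderiv_graph hu, fderiv_graph hd, fderiv_graph hd]

end Calculus

/-! ### Jets in terms of Fréchet derivatives, and polynomial representatives of jets. -/

theorem partialT_eq {u : ℝ × ℝ → ℂ} {p : ℝ × ℝ} (hu : DifferentiableAt ℝ u p) :
    partialT u p = fderiv ℝ u p (1, 0) := by
  have h : HasDerivAt (fun s : ℝ => (s, p.2)) ((1 : ℝ), (0 : ℝ)) p.1 :=
    (hasDerivAt_id _).prodMk (hasDerivAt_const _ _)
  exact (HasFDerivAt.comp_hasDerivAt p.1 (l := u) hu.hasFDerivAt h).deriv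

theorem partialX_eq {u : ℝ × ℝ → ℂ} {p : ℝ × ℝ} (hu : DifferentiableAt ℝ u p) :
    partialX u p = fderiv ℝ u p (0, 1) := by
  have h : HasDerivAt (fun s : ℝ => (p.1, s)) ((0 : ℝ), (1 : ℝ)) p.2 :=
    (hasDerivAt_const _ _).prodMk (hasDerivAt_id _)
  exact (HasFDerivAt.comp_hasDerivAt p.2 (l := u) hu.hasFDerivAt h).deriv

theorem _root_.Filter.EventuallyEq.partialT_eq {u v : ℝ × ℝ → ℂ} {p : ℝ × ℝ} (h : u =ᶠ[𝓝 p] v) :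
    partialT u p = partialT v p := by
  have hc : ContinuousAt (fun s : ℝ => (s, p.2)) p.1 := by fun_prop
  exact Filter.EventuallyEq.deriv_eq (hc.eventually h)

theorem _root_.Filter.EventuallyEq.partialX_eq {u v : ℝ × ℝ → ℂ} {p : ℝ × ℝ} (h : u =ᶠ[𝓝 p] v) :
    partialX u p = partialX v p := by
  have hc : ContinuousAt (fun s : ℝ => (p.1, s)) p.2 := by fun_prop
  exact Filter.EventuallyEq.deriv_eq (hc.eventually h)

theorem jetOf_eq {u : ℝ × ℝ → ℂ} {p : ℝ × ℝ} (hu : ContDiffAt ℝ 2 u p) :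
    jetOf u p = ((p, u p), (fderiv ℝ u p (1, 0), fderiv ℝ u p (0, 1)),
      (fderiv ℝ (fderiv ℝ u) p (1, 0) (1, 0), fderiv ℝ (fderiv ℝ u) p (1, 0) (0, 1),
        fderiv ℝ (fderiv ℝ u) p (0, 1) (0, 1))) := by
  have hd : DifferentiableAt ℝ u p := hu.differentiableAt (by simp)
  have hT : partialT u =ᶠ[𝓝 p] fun q => fderiv ℝ u q (1, 0) := by
    filter_upwards [eventually_differentiableAt hu] with q hq using partialT_eq hq
  have hX : partialX u =ᶠ[𝓝 p] fun q => fderiv ℝ u q (0, 1) := by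
    filter_upwards [eventually_differentiableAt hu] with q hq using partialX_eq hq
  have hD (w : ℝ × ℝ) : DifferentiableAt ℝ (fun q => fderiv ℝ u q w) p :=
    (differentiableAt_fderiv hu).clm_apply (differentiableAt_const w)
  rw [jetOf, hT.partialT_eq, hX.partialT_eq, hX.partialX_eq, partialT_eq (hD _),
    partialT_eq (hD _), partialX_eq (hD _), fderiv_fderiv_apply hu, fderiv_fderiv_apply hu,
    fderiv_fderiv_apply hu, partialT_eq hd, partialX_eq hd]

/-- The polynomial with the second-order jet `j` at the point below `j`. -/
def jetPoly (j : Jet) (q : ℝ × ℝ) : ℂ :=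
  j.1.2 + (q.1 - j.1.1.1) • j.2.1.1 + (q.2 - j.1.1.2) • j.2.1.2 +
    ((q.1 - j.1.1.1) ^ 2 / 2) • j.2.2.1 +
    ((q.1 - j.1.1.1) * (q.2 - j.1.1.2)) • j.2.2.2.1 + ((q.2 - j.1.1.2) ^ 2 / 2) • j.2.2.2.2

theorem contDiff_jetPoly (j : Jet) {n : WithTop ℕ∞} : ContDiff ℝ n (jetPoly j) := by
  unfold jetPoly
  fun_prop

theorem partialT_jetPoly (j : Jet) : partialT (jetPoly j) = fun q =>
    j.2.1.1 + (q.1 - j.1.1.1) • j.2.2.1 + (q.2 - j.1.1.2) • j.2.2.2.1 := by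
  ext1 q
  have h : HasDerivAt (fun s : ℝ => s - j.1.1.1) 1 q.1 := (hasDerivAt_id _).sub_const _
  have := (((((hasDerivAt_const q.1 j.1.2).add (h.smul_const j.2.1.1)).add_const
    ((q.2 - j.1.1.2) • j.2.1.2)).add (((h.pow 2).div_const 2).smul_const j.2.2.1)).add
    ((h.mul_const (q.2 - j.1.1.2)).smul_const j.2.2.2.1)).add_const
      (((q.2 - j.1.1.2) ^ 2 / 2) • j.2.2.2.2)
  refine this.deriv.trans ?_
  simp

theorem partialX_jetPoly (j : Jet) : partialX (jetPoly j) = fun q =>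
    j.2.1.2 + (q.1 - j.1.1.1) • j.2.2.2.1 + (q.2 - j.1.1.2) • j.2.2.2.2 := by
  ext1 q
  have h : HasDerivAt (fun s : ℝ => s - j.1.1.2) 1 q.2 := (hasDerivAt_id _).sub_const _
  have := (((hasDerivAt_const q.2 (j.1.2 + (q.1 - j.1.1.1) • j.2.1.1)).add
    (h.smul_const j.2.1.2)).add_const (((q.1 - j.1.1.1) ^ 2 / 2) • j.2.2.1)).add
    ((h.const_mul (q.1 - j.1.1.1)).smul_const j.2.2.2.1) |>.add
      (((h.pow 2).div_const 2).smul_const j.2.2.2.2)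
  refine this.deriv.trans ?_
  simp

theorem jetOf_jetPoly (j : Jet) : jetOf (jetPoly j) j.1.1 = j := by
  have h (a : ℝ) (c : ℂ) (x : ℝ) : deriv (fun s : ℝ => (s - a) • c) x = c := by
    simpa using (((hasDerivAt_id x).sub_const a).smul_const c).deriv
  have h1 : partialT (partialT (jetPoly j)) j.1.1 = j.2.2.1 := by
    rw [partialT_jetPoly, partialT]
    simp only [sub_self, zero_smul, add_zero, deriv_const_add']
    exact h _ _ _
  have h2 : partialT (partialX (jetPoly j)) j.1.1 = j.2.2.2.1 := by
    rw [partialX_jetPoly, partialT]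
    simp only [sub_self, zero_smul, add_zero, deriv_const_add']
    exact h _ _ _
  have h3 : partialX (partialX (jetPoly j)) j.1.1 = j.2.2.2.2 := by
    rw [partialX_jetPoly, partialX]
    simp only [sub_self, zero_smul, add_zero, deriv_const_add']
    exact h _ _ _
  rw [jetOf, h1, h2, h3, partialT_jetPoly, partialX_jetPoly]
  simp [jetPoly]

/-! ### Prolongation -/

/-- The differential encoded in a jet. -/
def Jet.slope (j : Jet) (ξ : ℝ × ℝ) : ℂ := ξ.1 • j.2.1.1 + ξ.2 • j.2.1.2

/-- The second differential encoded in a jet. -/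
def Jet.curv (j : Jet) (ξ η : ℝ × ℝ) : ℂ :=
  (ξ.1 * η.1) • j.2.2.1 + (ξ.1 * η.2 + ξ.2 * η.1) • j.2.2.2.1 + (ξ.2 * η.2) • j.2.2.2.2

/-- The lift of a vector to the plane tangent to the graph of a function with jet `j`. -/
def Jet.lift (j : Jet) (ξ : ℝ × ℝ) : Base := (ξ, j.slope ξ)

/-- The second derivative of `φ` along the graph of a function with jet `j`. -/
def totalSnd (φ : Base → Base) (j : Jet) (ξ η : ℝ × ℝ) : Base :=
  fderiv ℝ (fderiv ℝ φ) j.1 (j.lift ξ) (j.lift η) + fderiv ℝ φ j.1 (0, j.curv ξ η)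

theorem two_le_infty : (2 : WithTop ℕ∞) ≤ ∞ :=
  WithTop.coe_le_coe.mpr (le_top : (2 : ℕ∞) ≤ ⊤)

theorem clm_prod_apply {G : Type*} [NormedAddCommGroup G] [NormedSpace ℝ G]
    (L : ℝ × ℝ →L[ℝ] G) (ξ : ℝ × ℝ) : L ξ = ξ.1 • L (1, 0) + ξ.2 • L (0, 1) := by
  rw [← map_smul, ← map_smul, ← map_add]
  simp

theorem fderiv_eq_slope {u : ℝ × ℝ → ℂ} {p : ℝ × ℝ} (hu : ContDiffAt ℝ 2 u p) (ξ : ℝ × ℝ) :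
    fderiv ℝ u p ξ = (jetOf u p).slope ξ := by
  rw [jetOf_eq hu, clm_prod_apply]
  rfl

theorem fderiv_fderiv_eq_curv {u : ℝ × ℝ → ℂ} {p : ℝ × ℝ} (hu : ContDiffAt ℝ 2 u p)
    (ξ η : ℝ × ℝ) : fderiv ℝ (fderiv ℝ u) p ξ η = (jetOf u p).curv ξ η := by
  rw [jetOf_eq hu, clm_prod_apply (fderiv ℝ (fderiv ℝ u) p)]
  simp only [add_apply, smul_apply, Jet.curv]
  rw [clm_prod_apply (fderiv ℝ (fderiv ℝ u) p (1, 0)) η,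
    clm_prod_apply (fderiv ℝ (fderiv ℝ u) p (0, 1)) η, fderiv_fderiv_symm hu (0, 1) (1, 0)]
  module

theorem IsPointTransformation.contDiffAt {E : Type*} [NormedAddCommGroup E] [NormedSpace ℝ E]
    {e : OpenPartialHomeomorph E E} (he : IsPointTransformation e) {z : E} (hz : z ∈ e.source) :
    ContDiffAt ℝ ∞ e z := he.1.contDiffAt (e.open_source.mem_nhds hz)

theorem IsPointTransformation.symm {E : Type*} [NormedAddCommGroup E] [NormedSpace ℝ E]
    {e : OpenPartialHomeomorph E E} (he : IsPointTransformation e) :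
    IsPointTransformation e.symm := ⟨he.2, he.1⟩

theorem IsPointTransformation.fderiv_injective {E : Type*} [NormedAddCommGroup E] [NormedSpace ℝ E]
    {e : OpenPartialHomeomorph E E} (he : IsPointTransformation e) {z : E} (hz : z ∈ e.source) :
    Function.Injective (fderiv ℝ e z) := by
  have h1 : DifferentiableAt ℝ e z := (he.contDiffAt hz).differentiableAt (by simp)
  have h2 : DifferentiableAt ℝ e.symm (e z) :=
    (he.symm.contDiffAt (e.map_source hz)).differentiableAt (by simp)
  have h3 : (fun y => e.symm (e y)) =ᶠ[𝓝 z] id := by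
    filter_upwards [e.open_source.mem_nhds hz] with y hy using e.left_inv hy
  have h4 := h2.hasFDerivAt.comp z h1.hasFDerivAt
  have h5 := h4.unique ((hasFDerivAt_id z).congr_of_eventuallyEq h3)
  intro v w hvw
  have := congrArg (fderiv ℝ e.symm (e z)) hvw
  rw [← ContinuousLinearMap.comp_apply, ← ContinuousLinearMap.comp_apply, h5] at this
  simpa using this

section Prolongs

variable {φ : OpenPartialHomeomorph Base Base} {j j' : Jet}

theorem Prolongs.mem_source (h : Prolongs φ j j') : j.1 ∈ φ.source := by
  obtain ⟨u, v, p, p', hu, hv, rfl, rfl, hz, -, -⟩ := h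
  exact hz

theorem Prolongs.apply_eq (h : Prolongs φ j j') : φ j.1 = j'.1 := by
  obtain ⟨u, v, p, p', hu, hv, rfl, rfl, hz, h, -⟩ := h
  exact h

/-- The image of the tangent plane of the graph of `u` is tangent to the graph of `v`: differentiate
the identity `v (φ (q, u q)).1 = (φ (q, u q)).2` once. -/
theorem Prolongs.slope_eq (hφ : IsPointTransformation φ) (h : Prolongs φ j j') (ξ : ℝ × ℝ) :
    j'.slope (fderiv ℝ φ j.1 (j.lift ξ)).1 = (fderiv ℝ φ j.1 (j.lift ξ)).2 := by
  obtain ⟨u, v, p, p', hu, hv, rfl, rfl, hz, hpt, hev⟩ := h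
  have hu2 : ContDiffAt ℝ 2 u p := hu.of_le two_le_infty
  have hv2 : ContDiffAt ℝ 2 v p' := hv.of_le two_le_infty
  have hud := hu2.differentiableAt (by simp)
  have hd : DifferentiableAt ℝ φ (p, u p) := (hφ.contDiffAt hz).differentiableAt (by simp)
  have hg : DifferentiableAt ℝ (fun q => φ (q, u q)) p :=
    hd.comp p (differentiableAt_id.prodMk hud)
  have hvd : DifferentiableAt ℝ v (φ (p, u p)).1 := by
    rw [hpt]; exact hv2.differentiableAt (by simp)
  have h1 := hvd.hasFDerivAt.comp p hg.hasFDerivAt.fst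
  have h2 := (h1.congr_of_eventuallyEq (hev.mono fun q hq => hq.symm)).unique hg.hasFDerivAt.snd
  have h3 := DFunLike.congr_fun h2 ξ
  simp only [ContinuousLinearMap.comp_apply, ContinuousLinearMap.coe_fst',
    ContinuousLinearMap.coe_snd', fderiv_comp_graph hud hd, fderiv_eq_slope hu2] at h3
  rw [hpt, fderiv_eq_slope hv2] at h3
  exact h3

/-- The same identity differentiated twice; the slope term comes from the second derivative of the
inner function. -/
theorem Prolongs.curv_eq (hφ : IsPointTransformation φ) (h : Prolongs φ j j') (ξ η : ℝ × ℝ) :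
    j'.curv (fderiv ℝ φ j.1 (j.lift ξ)).1 (fderiv ℝ φ j.1 (j.lift η)).1 +
      j'.slope (totalSnd φ j ξ η).1 = (totalSnd φ j ξ η).2 := by
  obtain ⟨u, v, p, p', hu, hv, rfl, rfl, hz, hpt, hev⟩ := h
  have hu2 : ContDiffAt ℝ 2 u p := hu.of_le two_le_infty
  have hv2 : ContDiffAt ℝ 2 v p' := hv.of_le two_le_infty
  have hud := hu2.differentiableAt (by simp)
  have hφ2 : ContDiffAt ℝ 2 φ (p, u p) := (hφ.contDiffAt hz).of_le two_le_infty
  have hd : DifferentiableAt ℝ φ (p, u p) := hφ2.differentiableAt (by simp)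
  have hg : ContDiffAt ℝ 2 (fun q => φ (q, u q)) p :=
    hφ2.comp p (contDiffAt_id.prodMk hu2)
  have hgd := hg.differentiableAt (by simp)
  have hvp : ContDiffAt ℝ 2 v (φ (p, u p)).1 := by rw [hpt]; exact hv2
  have h1 := fderiv_fderiv_comp (g := v) (f := fun q => (φ (q, u q)).1) hvp hg.fst ξ η
  have h2 : fderiv ℝ (fun q => v (φ (q, u q)).1) =ᶠ[𝓝 p] fderiv ℝ (fun q => (φ (q, u q)).2) :=
    Filter.EventuallyEq.fderiv hev
  have h3 := fderiv_fderiv_clm_comp (ContinuousLinearMap.fst ℝ (ℝ × ℝ) ℂ) hg ξ η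
  have h4 := fderiv_fderiv_clm_comp (ContinuousLinearMap.snd ℝ (ℝ × ℝ) ℂ) hg ξ η
  have h5 : fderiv ℝ (fun q => (φ (q, u q)).1) p = _ := hgd.hasFDerivAt.fst.fderiv
  simp only [ContinuousLinearMap.coe_fst', ContinuousLinearMap.coe_snd'] at h3 h4
  rw [h2.fderiv_eq, h3, h4, h5, fderiv_fderiv_comp_graph hu2 hφ2] at h1
  simp only [ContinuousLinearMap.comp_apply, ContinuousLinearMap.coe_fst',
    fderiv_comp_graph hud hd, fderiv_eq_slope hu2, fderiv_fderiv_eq_curv hu2] at h1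
  rw [hpt, fderiv_eq_slope hv2, fderiv_fderiv_eq_curv hv2] at h1
  exact h1.symm

theorem Jet.slope_zero (j : Jet) : j.slope 0 = 0 := by simp [Jet.slope]

/-- The image plane lies in the tangent plane of a graph, so a vector of it with zero projection
vanishes; injectivity of the differential does the rest. -/
theorem Prolongs.eq_zero (hφ : IsPointTransformation φ) (h : Prolongs φ j j') {ξ : ℝ × ℝ}
    (hξ : (fderiv ℝ φ j.1 (j.lift ξ)).1 = 0) : ξ = 0 := by
  have h1 := h.slope_eq hφ ξ
  rw [hξ, Jet.slope_zero] at h1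
  have h2 : fderiv ℝ φ j.1 (j.lift ξ) = fderiv ℝ φ j.1 0 := by
    rw [map_zero]; exact Prod.ext hξ h1.symm
  exact congrArg Prod.fst (hφ.fderiv_injective h.mem_source h2)

/-- The linear part of the projection of the image of the graph of a function with jet `j`. -/
def baseLin (φ : Base → Base) (j : Jet) : ℝ × ℝ →ₗ[ℝ] ℝ × ℝ where
  toFun ξ := (fderiv ℝ φ j.1 (j.lift ξ)).1
  map_add' ξ η := by
    rw [← Prod.fst_add, ← map_add]
    congr 2
    simp only [Jet.lift, Jet.slope, Prod.mk_add_mk, Prod.fst_add, Prod.snd_add]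
    congr 1
    module
  map_smul' c ξ := by
    rw [RingHom.id_apply, ← Prod.smul_fst, ← map_smul]
    congr 2
    simp only [Jet.lift, Jet.slope, Prod.smul_mk, Prod.smul_fst, Prod.smul_snd, smul_eq_mul]
    congr 1
    module

theorem baseLin_surjective {f : Base → Base} (h : ∀ ξ, (fderiv ℝ f j.1 (j.lift ξ)).1 = 0 → ξ = 0) :
    Function.Surjective (baseLin f j) := by
  refine LinearMap.injective_iff_surjective.mp ?_
  rw [← LinearMap.ker_eq_bot, LinearMap.ker_eq_bot']
  exact h

/-- Transversality suffices: the image of the graph of the polynomial `jetPoly j` projects to the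
new `(t, x)` by a local diffeomorphism, so it is again locally the graph of a function. -/
theorem exists_prolongs (hφ : IsPointTransformation φ) (hj : j.1 ∈ φ.source)
    (h : ∀ ξ, (fderiv ℝ φ j.1 (j.lift ξ)).1 = 0 → ξ = 0) : ∃ j', Prolongs φ j j' := by
  set u := jetPoly j
  have hu : ContDiffAt ℝ ∞ u j.1.1 := (contDiff_jetPoly j).contDiffAt
  have hjet : jetOf u j.1.1 = j := jetOf_jetPoly j
  have hup : (j.1.1, u j.1.1) = j.1 := congrArg Prod.fst hjet
  have hu2 : ContDiffAt ℝ 2 u j.1.1 := hu.of_le two_le_infty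
  have hud := hu2.differentiableAt (by simp)
  have hφ' : ContDiffAt ℝ ∞ φ (j.1.1, u j.1.1) := by rw [hup]; exact hφ.contDiffAt hj
  have hγ : ContDiffAt ℝ ∞ (fun q => φ (q, u q)) j.1.1 :=
    hφ'.comp (f := fun q => (q, u q)) _ (contDiffAt_id.prodMk hu)
  have hγd := hγ.differentiableAt (by simp)
  let A : (ℝ × ℝ) ≃L[ℝ] (ℝ × ℝ) := (LinearEquiv.ofBijective (baseLin φ j)
    ⟨LinearMap.injective_iff_surjective.mpr (baseLin_surjective h),
      baseLin_surjective h⟩).toContinuousLinearEquiv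
  have hA : HasFDerivAt (fun q => (φ (q, u q)).1) (A : ℝ × ℝ →L[ℝ] ℝ × ℝ) j.1.1 := by
    have h1 := hγd.hasFDerivAt.fst
    refine h1.congr_fderiv (ContinuousLinearMap.ext fun ξ => ?_)
    rw [ContinuousLinearMap.comp_apply, ContinuousLinearMap.coe_fst',
      fderiv_comp_graph hud (hφ'.differentiableAt (by simp)), fderiv_eq_slope hu2, hjet, hup]
    rfl
  let e := hγ.fst.toOpenPartialHomeomorph (fun q => (φ (q, u q)).1) hA (by simp)
  have he : ∀ q, e q = (φ (q, u q)).1 := fun q => rfl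
  have hmem : j.1.1 ∈ e.source := hγ.fst.mem_toOpenPartialHomeomorph_source hA (by simp)
  have hsm : ContDiffAt ℝ ∞ e.symm (e j.1.1) := hγ.fst.to_localInverse hA (by simp)
  refine ⟨jetOf (fun y => (φ (e.symm y, u (e.symm y))).2) (e j.1.1), u, _, j.1.1, e j.1.1, hu, ?_,
    hjet, rfl, by rw [hup]; exact hj, ?_, ?_⟩
  · have h2 : ContDiffAt ℝ ∞ (fun q => φ (q, u q)) (e.symm (e j.1.1)) := by
      rw [e.left_inv hmem]; exact hγ
    exact (h2.comp (e j.1.1) hsm).snd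
  · rw [e.left_inv hmem]
    rfl
  · filter_upwards [e.open_source.mem_nhds hmem] with q hq
    rw [← he, e.left_inv hq]

theorem Prolongs.symm (hφ : IsPointTransformation φ) (h : Prolongs φ j j') :
    Prolongs φ.symm j' j := by
  have hnd := fun ξ => h.eq_zero hφ (ξ := ξ)
  obtain ⟨u, v, p, p', hu, hv, rfl, rfl, hz, hpt, hev⟩ := h
  have hpt' : φ.symm (p', v p') = (p, u p) := by rw [← hpt, φ.left_inv hz]
  refine ⟨v, u, p', p, hv, hu, rfl, rfl, ?_, hpt', ?_⟩
  · rw [← hpt]; exact φ.map_source hz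
  have hu2 : ContDiffAt ℝ 2 u p := hu.of_le two_le_infty
  have hud := hu2.differentiableAt (by simp)
  have hφ' : ContDiffAt ℝ ∞ φ (p, u p) := hφ.contDiffAt hz
  have hγ : ContDiffAt ℝ ∞ (fun q => φ (q, u q)) p :=
    hφ'.comp (f := fun q => (q, u q)) _ (contDiffAt_id.prodMk hu)
  have hstr := hγ.fst.hasStrictFDerivAt (by simp)
  have hrange : (fderiv ℝ (fun q => (φ (q, u q)).1) p).range = ⊤ := by
    rw [LinearMap.range_eq_top]
    intro y
    obtain ⟨ξ, hξ⟩ := baseLin_surjective hnd y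
    refine ⟨ξ, ?_⟩
    have h5 : fderiv ℝ (fun q => (φ (q, u q)).1) p = _ :=
      (hγ.differentiableAt (by simp)).hasFDerivAt.fst.fderiv
    rw [← hξ, h5]
    simp only [ContinuousLinearMap.coe_coe, ContinuousLinearMap.comp_apply,
      ContinuousLinearMap.coe_fst',
      fderiv_comp_graph hud (hφ'.differentiableAt (by simp)), fderiv_eq_slope hu2]
    rfl
  -- The identity is known along the parametrization of the image graph. The parametrization pushes
  -- neighbourhoods of `p` onto neighbourhoods of `p'`, so the identity holds on a full
  -- neighbourhood of `p'`.
  have hmap := hstr.map_nhds_eq_of_surj hrange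
  rw [hpt] at hmap
  change ∀ᶠ q in 𝓝 (p', v p').1, _
  rw [← hmap, eventually_map]
  have hs : ∀ᶠ q in 𝓝 p, (q, u q) ∈ φ.source :=
    (continuousAt_id.prodMk hud.continuousAt).eventually (φ.open_source.mem_nhds hz)
  filter_upwards [hev, hs] with q hq hq'
  rw [hq, Prod.mk.eta, φ.left_inv hq']

theorem prolongs_symm_iff (hφ : IsPointTransformation φ) :
    Prolongs φ.symm j' j ↔ Prolongs φ j j' :=
  ⟨fun h => by simpa using h.symm hφ.symm, fun h => h.symm hφ⟩

/-- The prolongation acts on the variables of order at most one on its own. -/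
theorem Prolongs.slope_congr (hφ : IsPointTransformation φ) {k k' : Jet} (hj : Prolongs φ j j')
    (hk : Prolongs φ k k') (h0 : j.1 = k.1) (h1 : j.2.1 = k.2.1) (ζ : ℝ × ℝ) :
    j'.slope ζ = k'.slope ζ := by
  obtain ⟨ξ, rfl⟩ := baseLin_surjective (fun ξ => hj.eq_zero hφ (ξ := ξ)) ζ
  have hl : j.lift ξ = k.lift ξ := by simp only [Jet.lift, Jet.slope, h1]
  refine (hj.slope_eq hφ ξ).trans ?_
  have := (hk.slope_eq hφ ξ).symm
  rw [← h0, ← hl] at this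
  exact this

end Prolongs

/-! ### The determining conditions for admissible transformations -/

/-- The shape of the differentials of the equivalence transformations: the new `t` depends
on `t` only, the new `x` on `t` and `x`, the scalings of `t` and `x` match, and the new `ψ` is
holomorphic or antiholomorphic in `ψ` according to the sign of the scaling of `t`. -/
structure IsReduced (D : Base →L[ℝ] Base) : Prop where
  time : ∀ (y : ℝ) (η : ℂ), (D ((0, y), η)).1.1 = 0
  space : ∀ η : ℂ, (D (0, η)).1.2 = 0
  time_ne : (D ((1, 0), 0)).1.1 ≠ 0
  scale : (D ((0, 1), 0)).1.2 ^ 2 = |(D ((1, 0), 0)).1.1|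
  conf : ∀ η : ℂ, (D (0, Complex.I * η)).2 =
    ((D ((1, 0), 0)).1.1 / |(D ((1, 0), 0)).1.1|) • (Complex.I * (D (0, η)).2)

theorem base_decomp (w : Base) : w = w.1.1 • ((1, 0), 0) + w.1.2 • ((0, 1), 0) + (0, w.2) := by
  obtain ⟨⟨s, y⟩, c⟩ := w
  simp

theorem clm_base_apply {G : Type*} [NormedAddCommGroup G] [NormedSpace ℝ G] (D : Base →L[ℝ] G)
    (w : Base) : D w = w.1.1 • D ((1, 0), 0) + w.1.2 • D ((0, 1), 0) + D (0, w.2) := by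
  conv_lhs => rw [base_decomp w]
  rw [map_add, map_add, map_smul, map_smul]

theorem clm_snd_add {G : Type*} [NormedAddCommGroup G] [NormedSpace ℝ G] (D : Base →L[ℝ] G)
    (ξ : ℝ × ℝ) (a b : ℂ) : D (ξ, a + b) = D (ξ, a) + D (0, b) := by
  rw [← map_add]
  simp

theorem clm_snd_smul {G : Type*} [NormedAddCommGroup G] [NormedSpace ℝ G] (D : Base →L[ℝ] G)
    (r : ℝ) (a : ℂ) : D (0, r • a) = r • D (0, a) := by
  rw [← map_smul]
  simp

/-- If every lift of `∂_t` projected to a multiple of the image of `∂_x + η ∂_ψ`, the composite of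
`D` with the projection to `(t, x)` would have rank at most one, although `D` is onto. The lemma
supplies a value of `ψ_t` at which the prolongation is defined. -/
theorem exists_not_parallel {D : Base →L[ℝ] Base} (hD : Function.Injective D) (η : ℂ) :
    ∃ a : ℂ, ∀ r : ℝ, (D ((1, 0), a)).1 ≠ r • (D ((0, 1), η)).1 := by
  by_contra! h
  have hsurj : Function.Surjective D := LinearMap.injective_iff_surjective.mp hD
  have key : ∀ w : Base, ∃ r : ℝ, (D w).1 = r • (D ((0, 1), η)).1 := by
    intro w
    obtain ⟨r0, h0⟩ := h 0
    obtain ⟨r1, h1⟩ := h (w.2 - w.1.2 • η)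
    -- Decompose `w` along `((1, 0), 0)`, `((0, 1), η)` and a vertical vector; the latter is a
    -- difference of two lifts of `∂_t`, which accounts for `r1 - r0`.
    refine ⟨w.1.1 * r0 + w.1.2 + (r1 - r0), ?_⟩
    have e1 : D (0, w.2 - w.1.2 • η) = D ((1, 0), w.2 - w.1.2 • η) - D ((1, 0), 0) := by
      rw [← map_sub]; simp
    have e2 : D w = w.1.1 • D ((1, 0), 0) + w.1.2 • D ((0, 1), η) + D (0, w.2 - w.1.2 • η) := by
      rw [← map_smul, ← map_smul, ← map_add, ← map_add]
      congr 1
      obtain ⟨⟨s, y⟩, c⟩ := w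
      simp
    rw [e2, e1]
    simp only [Prod.fst_add, Prod.smul_fst, Prod.fst_sub, h0, h1]
    module
  obtain ⟨w1, hw1⟩ := hsurj ((1, 0), 0)
  obtain ⟨w2, hw2⟩ := hsurj ((0, 1), 0)
  obtain ⟨r1, h1⟩ := key w1
  obtain ⟨r2, h2⟩ := key w2
  rw [hw1] at h1
  rw [hw2] at h2
  have a1 := congrArg Prod.fst h1
  have a2 := congrArg Prod.snd h1
  have b1 := congrArg Prod.fst h2
  have b2 := congrArg Prod.snd h2
  simp only [Prod.smul_fst, Prod.smul_snd, smul_eq_mul] at a1 a2 b1 b2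
  have hr1 : r1 ≠ 0 := by rintro rfl; simp at a1
  have hy : (D ((0, 1), η)).1.2 = 0 := by
    rcases mul_eq_zero.mp a2.symm with h | h
    · exact absurd h hr1
    · exact h
  rw [hy] at b2
  simp at b2

/-- The range up to `3` provides the four equally spaced points needed for a third finite
difference. -/
theorem exists_segment_mem {U : Set ℂ} {a : ℂ} (hU : U ∈ 𝓝 a) (δ : ℂ) :
    ∃ h : ℝ, 0 < h ∧ ∀ s : ℝ, 0 ≤ s → s ≤ 3 → a + (s * h) • δ ∈ U := by
  have hc : ContinuousAt (fun r : ℝ => a + r • δ) 0 := by fun_prop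
  have hU' : U ∈ 𝓝 ((fun r : ℝ => a + r • δ) 0) := by simpa using hU
  obtain ⟨ε, hε, hball⟩ := Metric.mem_nhds_iff.mp (hc hU')
  refine ⟨ε / 4, by positivity, fun s h0 h3 => hball ?_⟩
  rw [Metric.mem_ball, dist_zero_right, Real.norm_eq_abs, abs_of_nonneg (by positivity)]
  nlinarith

section

variable {φ : OpenPartialHomeomorph Base Base} {F F' : ArbitraryElement} {j j' k k' : Jet}

/-- The image tangent plane is two-dimensional and projects onto the new `(t, x)`-plane, so it is
the whole tangent plane of the target graph. A vertical vector mapped into it is therefore tangent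
to the source graph, hence zero. -/
theorem Prolongs.vertical_eq_zero (hφ : IsPointTransformation φ) (h : Prolongs φ j j') {δ : ℂ}
    (hδ : j'.slope (fderiv ℝ φ j.1 (0, δ)).1 = (fderiv ℝ φ j.1 (0, δ)).2) : δ = 0 := by
  obtain ⟨ξ, hξ⟩ := baseLin_surjective (fun ξ => h.eq_zero hφ (ξ := ξ)) (fderiv ℝ φ j.1 (0, δ)).1
  change (fderiv ℝ φ j.1 (j.lift ξ)).1 = _ at hξ
  have h1 := h.slope_eq hφ ξ
  rw [hξ, hδ] at h1
  have h2 : fderiv ℝ φ j.1 (j.lift ξ) = fderiv ℝ φ j.1 (0, δ) := Prod.ext hξ h1.symm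
  have h3 := hφ.fderiv_injective h.mem_source h2
  have h4 : ξ = 0 := congrArg Prod.fst h3
  have h5 : j.slope ξ = δ := congrArg Prod.snd h3
  rw [← h5, h4, Jet.slope_zero]

theorem Jet.curv_dx (j : Jet) : j.curv (0, 1) (0, 1) = j.2.2.2.2 := by simp [Jet.curv]

theorem Jet.slope_dx (j : Jet) : j.slope (0, 1) = j.2.1.2 := by simp [Jet.slope]

theorem Jet.slope_dt (j : Jet) : j.slope (1, 0) = j.2.1.1 := by simp [Jet.slope]

/-- The first-order parts of the image jets agree, so the target equation forces equal second
`x`-derivatives. Pulled back along the direction `ξ` mapped to the new `∂_x`, this equates the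
second derivatives of the source jets in that direction. -/
theorem Prolongs.curv_eq_of_mem (hφ : φ ∈ admissible F F') (hj : Prolongs φ j j')
    (hk : Prolongs φ k k') (h0 : j.1 = k.1) (h1 : j.2.1 = k.2.1) (hjF : j ∈ F.equation)
    (hkF : k ∈ F.equation) {ξ : ℝ × ℝ} (hξ : (fderiv ℝ φ j.1 (j.lift ξ)).1 = (0, 1)) :
    j.curv ξ ξ = k.curv ξ ξ := by
  have hs := hj.slope_congr hφ.1 hk h0 h1
  have hjF' := ((hφ.2.2.2 _ _ hj).mp hjF).2
  have hkF' := ((hφ.2.2.2 _ _ hk).mp hkF).2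
  have e0 : j'.1 = k'.1 := by rw [← hj.apply_eq, ← hk.apply_eq, h0]
  have e1 : j'.2.1 = k'.2.1 := by
    refine Prod.ext ?_ ?_
    · rw [← Jet.slope_dt, hs, Jet.slope_dt]
    · rw [← Jet.slope_dx, hs, Jet.slope_dx]
  have eargs : j'.args = k'.args := by rw [Jet.args, Jet.args, e0, e1]
  have exx : j'.2.2.2.2 = k'.2.2.2.2 := by
    rw [eargs, e1] at hjF'
    linear_combination hjF' - hkF'
  have hl : k.lift ξ = j.lift ξ := by simp only [Jet.lift, Jet.slope, h1]
  have cj := hj.curv_eq hφ.1 ξ ξ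
  have ck := hk.curv_eq hφ.1 ξ ξ
  rw [← h0, hl, hξ, Jet.curv_dx, ← exx, ← hs] at ck
  rw [hξ, Jet.curv_dx] at cj
  have hW : totalSnd φ j ξ ξ = totalSnd φ k ξ ξ + fderiv ℝ φ j.1 (0, j.curv ξ ξ - k.curv ξ ξ) := by
    have : j.curv ξ ξ = k.curv ξ ξ + (j.curv ξ ξ - k.curv ξ ξ) := by ring
    rw [totalSnd, this, clm_snd_add, totalSnd, hl, h0]
    simp only [add_sub_cancel_left]
    abel
  -- Subtracting the two curvature identities leaves the statement that the image of the vertical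
  -- vector `j.curv ξ ξ - k.curv ξ ξ` is tangent to the target graph.
  refine sub_eq_zero.mp (hj.vertical_eq_zero hφ.1 ?_)
  rw [hW] at cj
  have hadd : ∀ a b : ℝ × ℝ, j'.slope (a + b) = j'.slope a + j'.slope b := by
    intro a b; simp only [Jet.slope, Prod.fst_add, Prod.snd_add]; module
  rw [Prod.fst_add, Prod.snd_add, hadd] at cj
  linear_combination cj - ck

/-- Since `ψ_tt` does not enter the equation, `curv_eq_of_mem` applied to two jets differing only in
`ψ_tt` forces `ξ.1 = 0`. So the new `∂_x` is the image of a nonzero multiple of the total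
`x`-direction. -/
theorem admissible_time (hφ : φ ∈ admissible F F') {z : Base} (hz : z ∈ φ.source) {η : ℂ}
    (hη : (z, η) ∈ F.dom) : (fderiv ℝ φ z ((0, 1), η)).1.1 = 0 := by
  by_cases ha : (fderiv ℝ φ z ((0, 1), η)).1 = 0
  · rw [ha]; rfl
  obtain ⟨a, hpar⟩ := exists_not_parallel (hφ.1.fderiv_injective hz) η
  set f := F.toFun (z, η)
  -- Here `ψ_tt = c` is free, and `ψ_xx` is solved from the equation.
  let J : ℂ → Jet := fun c => (z, (a, η), (c, 0, -(Complex.I * a) - f))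
  have hlift : ∀ c ξ, (fderiv ℝ φ z ((J c).lift ξ)).1 =
      ξ.1 • (fderiv ℝ φ z ((1, 0), a)).1 + ξ.2 • (fderiv ℝ φ z ((0, 1), η)).1 := by
    intro c ξ
    rw [← Prod.smul_fst, ← Prod.smul_fst, ← map_smul, ← map_smul, ← Prod.fst_add, ← map_add]
    congr 2
    simp [J, Jet.lift, Jet.slope]
  have hnd : ∀ c ξ, (fderiv ℝ φ (J c).1 ((J c).lift ξ)).1 = 0 → ξ = 0 := by
    intro c ξ h
    change (fderiv ℝ φ z ((J c).lift ξ)).1 = 0 at h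
    rw [hlift] at h
    have h1 : ξ.1 = 0 := by
      by_contra h1
      refine hpar (-(ξ.1⁻¹ * ξ.2)) ?_
      have := congrArg (fun v => ξ.1⁻¹ • v) h
      simp only [smul_add, smul_smul, inv_mul_cancel₀ h1, one_smul, smul_zero] at this
      rw [eq_neg_of_add_eq_zero_left this, neg_smul]
    rw [h1, zero_smul, zero_add] at h
    exact Prod.ext h1 ((smul_eq_zero.mp h).resolve_right ha)
  have hmem : ∀ c, J c ∈ F.equation := fun c => ⟨hη, by
    change Complex.I * a + (-(Complex.I * a) - f) + f = 0
    ring⟩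
  obtain ⟨j0, h0⟩ := exists_prolongs (j := J 0) hφ.1 hz (hnd 0)
  obtain ⟨j1, h1⟩ := exists_prolongs (j := J 1) hφ.1 hz (hnd 1)
  obtain ⟨ξ, hξ⟩ := baseLin_surjective (hnd 0) (0, 1)
  have hc := h0.curv_eq_of_mem hφ h1 rfl rfl (hmem 0) (hmem 1) (ξ := ξ) hξ
  have hξ1 : ξ.1 = 0 := by
    simpa [J, Jet.curv] using hc
  change (fderiv ℝ φ z ((J 0).lift ξ)).1 = _ at hξ
  rw [hlift, hξ1, zero_smul, zero_add] at hξ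
  have e1 := congrArg Prod.fst hξ
  have e2 := congrArg Prod.snd hξ
  simp only [Prod.smul_fst, Prod.smul_snd, smul_eq_mul] at e1 e2
  rcases mul_eq_zero.mp e1 with h | h
  · rw [h] at e2; simp at e2
  · exact h

theorem exists_dom_nhds (hφ : φ ∈ admissible F F') {z : Base} (hz : z ∈ φ.source) :
    ∃ η : ℂ, {η | (z, η) ∈ F.dom} ∈ 𝓝 η := by
  obtain ⟨⟨z', η⟩, hη, rfl⟩ := hφ.2.1 hz
  refine ⟨η, (F.isOpen_dom.preimage ?_).mem_nhds hη⟩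
  fun_prop

/-- The expression in `admissible_time` is affine in `η` and vanishes on an open set of `η`, so its
linear and constant parts both vanish. -/
theorem admissible_time_eq_zero (hφ : φ ∈ admissible F F') {z : Base} (hz : z ∈ φ.source)
    (y : ℝ) (η : ℂ) : (fderiv ℝ φ z ((0, y), η)).1.1 = 0 := by
  obtain ⟨η₀, hU⟩ := exists_dom_nhds hφ hz
  have hη₀ := mem_of_mem_nhds hU
  have hvert : ∀ δ : ℂ, (fderiv ℝ φ z (0, δ)).1.1 = 0 := by
    intro δ
    obtain ⟨h, hh, hs⟩ := exists_segment_mem hU δ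
    have h1 := admissible_time hφ hz (hs 1 (by norm_num) (by norm_num))
    rw [clm_snd_add, clm_snd_smul, Prod.fst_add, Prod.fst_add, admissible_time hφ hz hη₀] at h1
    simpa [hh.ne'] using h1
  have h2 := admissible_time hφ hz hη₀
  have e1 : (((0, 1), η₀) : Base) = ((0, 1), 0 + η₀) := by simp
  rw [e1, clm_snd_add, Prod.fst_add, Prod.fst_add, hvert, add_zero] at h2
  rw [clm_base_apply]
  simp [h2, hvert]

theorem fderiv_time_ne_zero {D : Base →L[ℝ] Base} (hD : Function.Injective D)
    (ht : ∀ (y : ℝ) (η : ℂ), (D ((0, y), η)).1.1 = 0) : (D ((1, 0), 0)).1.1 ≠ 0 := by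
  intro h
  obtain ⟨w, hw⟩ := LinearMap.injective_iff_surjective.mp hD ((1, 0), 0)
  change D w = _ at hw
  have h1 := congrArg (fun v : Base => v.1.1) hw
  have h0 : (D (0, w.2)).1.1 = 0 := ht 0 w.2
  rw [clm_base_apply] at h1
  simp [h, h0, ht] at h1

theorem fderiv_space_ne_zero {D : Base →L[ℝ] Base} (hD : Function.Injective D)
    (ht : ∀ (y : ℝ) (η : ℂ), (D ((0, y), η)).1.1 = 0) (hs : ∀ η, (D (0, η)).1.2 = 0) :
    (D ((0, 1), 0)).1.2 ≠ 0 := by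
  intro h
  obtain ⟨w, hw⟩ := LinearMap.injective_iff_surjective.mp hD ((0, 1), 0)
  change D w = _ at hw
  have h1 := congrArg (fun v : Base => v.1.1) hw
  have h2 := congrArg (fun v : Base => v.1.2) hw
  have h0 : (D (0, w.2)).1.1 = 0 := ht 0 w.2
  rw [clm_base_apply] at h1 h2
  simp only [Prod.fst_add, Prod.smul_fst, Prod.snd_add, Prod.smul_snd, ht, h0, hs, h, mul_zero,
    add_zero, smul_eq_mul] at h1 h2
  rcases mul_eq_zero.mp h1 with h3 | h3
  · rw [h3] at h2; simp at h2
  · exact fderiv_time_ne_zero hD ht h3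

/-- If the new `t` depends on `t` only near `z`, its second derivatives in the other directions
vanish. -/
theorem fderiv_fderiv_time (hφ : IsPointTransformation φ)
    (ht : ∀ z ∈ φ.source, ∀ (y : ℝ) (η : ℂ), (fderiv ℝ φ z ((0, y), η)).1.1 = 0) {z : Base}
    (hz : z ∈ φ.source) (v : Base) (y : ℝ) (η : ℂ) :
    (fderiv ℝ (fderiv ℝ φ) z v ((0, y), η)).1.1 = 0 := by
  have h2 : ContDiffAt ℝ 2 φ z := (hφ.contDiffAt hz).of_le two_le_infty
  have hd := (differentiableAt_fderiv h2).hasFDerivAt.clm_apply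
    (hasFDerivAt_const (((0, y), η) : Base) z)
  have h3 : (fun x => (fderiv ℝ φ x ((0, y), η)).1.1) =ᶠ[𝓝 z] fun _ => (0 : ℝ) := by
    filter_upwards [φ.open_source.mem_nhds hz] with x hx using ht x hx y η
  have h4 := hd.fst.fst.unique ((hasFDerivAt_const (0 : ℝ) z).congr_of_eventuallyEq h3)
  simpa using DFunLike.congr_fun h4 v

end

/-! ### Scaling relation and the reduced form of the differential. -/

section

variable {φ : OpenPartialHomeomorph Base Base} {F F' : ArbitraryElement} {j j' k k' : Jet}

/-- The explicit form of the first and second prolongation in the case when the new `t` depends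
on `t` only. -/
theorem Prolongs.triangular (hφ : IsPointTransformation φ)
    (ht : ∀ z ∈ φ.source, ∀ (y : ℝ) (η : ℂ), (fderiv ℝ φ z ((0, y), η)).1.1 = 0)
    (h : Prolongs φ j j') :
    (fderiv ℝ φ j.1 ((0, 1), j.2.1.2)).1.2 • j'.2.1.2 = (fderiv ℝ φ j.1 ((0, 1), j.2.1.2)).2 ∧
    (fderiv ℝ φ j.1 ((1, 0), 0)).1.1 • j'.2.1.1
        + (fderiv ℝ φ j.1 ((1, 0), j.2.1.1)).1.2 • j'.2.1.2
      = (fderiv ℝ φ j.1 ((1, 0), j.2.1.1)).2 ∧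
    (fderiv ℝ φ j.1 ((0, 1), j.2.1.2)).1.2 ^ 2 • j'.2.2.2.2
        + (totalSnd φ j (0, 1) (0, 1)).1.2 • j'.2.1.2 = (totalSnd φ j (0, 1) (0, 1)).2 := by
  have hz := h.mem_source
  have lX : j.lift (0, 1) = ((0, 1), j.2.1.2) := by rw [Jet.lift, Jet.slope_dx]
  have lT : j.lift (1, 0) = ((1, 0), j.2.1.1) := by rw [Jet.lift, Jet.slope_dt]
  have sX := h.slope_eq hφ (0, 1)
  have sT := h.slope_eq hφ (1, 0)
  have cX := h.curv_eq hφ (0, 1) (0, 1)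
  have hW : (totalSnd φ j (0, 1) (0, 1)).1.1 = 0 := by
    rw [totalSnd, lX, Prod.fst_add, Prod.fst_add, fderiv_fderiv_time hφ ht hz]
    exact (zero_add _).trans (ht _ hz 0 _)
  have hT : (fderiv ℝ φ j.1 ((1, 0), j.2.1.1)).1.1 = (fderiv ℝ φ j.1 ((1, 0), 0)).1.1 := by
    rw [clm_base_apply]
    have : (fderiv ℝ φ j.1 (0, j.2.1.1)).1.1 = 0 := ht _ hz 0 _
    simp [this]
  rw [lX] at sX cX
  rw [lT] at sT
  rw [Jet.slope, ht _ hz] at sX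
  rw [Jet.slope, hT] at sT
  rw [Jet.slope, Jet.curv, ht _ hz, hW] at cX
  refine ⟨?_, sT, ?_⟩
  · rw [← sX]; simp
  · rw [← cX]; simp [sq]

/-- Vary `ψ_t = ζ` at fixed arguments of `F`, staying on the equation. If `B` is the vertical part
of the differential corrected by the new slope `b`, then `τ Δψ̃_t = B ζ` and `c² Δψ̃_xx = -B (iζ)`,
while the target equation gives `i Δψ̃_t + Δψ̃_xx = 0`. The resulting relation is the second
conjunct, and iterating it gives `c⁴ = τ²`. -/
theorem admissible_scale (hφ : φ ∈ admissible F F') {z : Base} (hz : z ∈ φ.source) {η : ℂ}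
    (hη : (z, η) ∈ F.dom) (hc : (fderiv ℝ φ z ((0, 1), η)).1.2 ≠ 0) :
    (fderiv ℝ φ z ((0, 1), η)).1.2 ^ 2 = |(fderiv ℝ φ z ((1, 0), 0)).1.1| ∧
    ∃ b : ℂ, ∀ ζ : ℂ, (fderiv ℝ φ z ((0, 1), η)).1.2 ^ 2 •
        (Complex.I * ((fderiv ℝ φ z (0, ζ)).2 - (fderiv ℝ φ z (0, ζ)).1.2 • b)) =
      (fderiv ℝ φ z ((1, 0), 0)).1.1 • ((fderiv ℝ φ z (0, Complex.I * ζ)).2 -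
        (fderiv ℝ φ z (0, Complex.I * ζ)).1.2 • b) := by
  have ht : ∀ z ∈ φ.source, ∀ (y : ℝ) (η : ℂ), (fderiv ℝ φ z ((0, y), η)).1.1 = 0 :=
    fun z hz => admissible_time_eq_zero hφ hz
  have hτ := fderiv_time_ne_zero (hφ.1.fderiv_injective hz) (ht z hz)
  set D := fderiv ℝ φ z with hD
  set c := (D ((0, 1), η)).1.2
  set τ := (D ((1, 0), 0)).1.1 with hτdef
  set f := F.toFun (z, η)
  -- The last entry keeps the jet on the equation while `ψ_t = ζ` varies.
  let J : ℂ → Jet := fun ζ => (z, (ζ, η), (0, 0, -(Complex.I * ζ) - f))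
  have hmem : ∀ ζ, J ζ ∈ F.equation := fun ζ => ⟨hη, by
    change Complex.I * ζ + (-(Complex.I * ζ) - f) + f = 0
    ring⟩
  have hT : ∀ ζ, (D ((1, 0), ζ)).1.1 = τ := by
    intro ζ
    rw [clm_base_apply]
    have : (D (0, ζ)).1.1 = 0 := ht _ hz 0 _
    simp [this, hτdef]
  have hnd : ∀ ζ ξ, (fderiv ℝ φ (J ζ).1 ((J ζ).lift ξ)).1 = 0 → ξ = 0 := by
    intro ζ ξ h
    change (D ((J ζ).lift ξ)).1 = 0 at h
    have e : (J ζ).lift ξ = ξ.1 • ((1, 0), ζ) + ξ.2 • ((0, 1), η) := by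
      simp [J, Jet.lift, Jet.slope]
    rw [e, map_add, map_smul, map_smul] at h
    have h1 := congrArg Prod.fst h
    have h2 := congrArg Prod.snd h
    have h0 : (D ((0, 1), η)).1.1 = 0 := ht z hz 1 η
    simp only [Prod.fst_add, Prod.snd_add, Prod.smul_fst, Prod.smul_snd, smul_eq_mul, hT,
      h0, mul_zero, add_zero, Prod.fst_zero, Prod.snd_zero] at h1 h2
    have h3 : ξ.1 = 0 := (mul_eq_zero.mp h1).resolve_right hτ
    rw [h3, zero_mul, zero_add] at h2
    exact Prod.ext h3 ((mul_eq_zero.mp h2).resolve_right hc)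
  have hex : ∀ ζ, ∃ j', Prolongs φ (J ζ) j' := fun ζ => exists_prolongs hφ.1 hz (hnd ζ)
  choose K hK using hex
  set b := (K 0).2.1.2
  have hbz : ∀ ζ, (K ζ).2.1.2 = b := by
    intro ζ
    have h1 := ((hK ζ).triangular hφ.1 ht).1
    have h0 := ((hK 0).triangular hφ.1 ht).1
    change c • (K ζ).2.1.2 = (D ((0, 1), η)).2 at h1
    change c • b = (D ((0, 1), η)).2 at h0
    exact smul_right_injective ℂ hc (h1.trans h0.symm)
  have hargs : ∀ ζ, (K ζ).args = (K 0).args := by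
    intro ζ
    rw [Jet.args, Jet.args, hbz, ← (hK ζ).apply_eq, ← (hK 0).apply_eq]
  have heq : ∀ ζ, Complex.I * ((K ζ).2.1.1 - (K 0).2.1.1)
      + ((K ζ).2.2.2.2 - (K 0).2.2.2.2) = 0 := by
    intro ζ
    have h1 := ((hφ.2.2.2 _ _ (hK ζ)).mp (hmem ζ)).2
    have h0 := ((hφ.2.2.2 _ _ (hK 0)).mp (hmem 0)).2
    rw [hargs] at h1
    linear_combination h1 - h0
  let B : ℂ → ℂ := fun ζ => (D (0, ζ)).2 - (D (0, ζ)).1.2 • b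
  have hBt : ∀ ζ, τ • ((K ζ).2.1.1 - (K 0).2.1.1) = B ζ := by
    intro ζ
    have h1 := ((hK ζ).triangular hφ.1 ht).2.1
    have h0 := ((hK 0).triangular hφ.1 ht).2.1
    change τ • (K ζ).2.1.1 + (D ((1, 0), ζ)).1.2 • (K ζ).2.1.2 = (D ((1, 0), ζ)).2 at h1
    change τ • (K 0).2.1.1 + (D ((1, 0), 0)).1.2 • (K 0).2.1.2 = (D ((1, 0), 0)).2 at h0
    have e : D ((1, 0), ζ) = D ((1, 0), 0) + D (0, ζ) := by
      rw [← clm_snd_add, zero_add]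
    rw [e, hbz] at h1
    simp only [Prod.fst_add, Prod.snd_add, add_smul] at h1
    simp only [B, smul_sub]
    linear_combination h1 - h0
  have hBx : ∀ ζ, c ^ 2 • ((K ζ).2.2.2.2 - (K 0).2.2.2.2) = -B (Complex.I * ζ) := by
    intro ζ
    have h1 := ((hK ζ).triangular hφ.1 ht).2.2
    have h0 := ((hK 0).triangular hφ.1 ht).2.2
    change c ^ 2 • (K ζ).2.2.2.2 + _ = _ at h1
    change c ^ 2 • (K 0).2.2.2.2 + _ = _ at h0
    have e : totalSnd φ (J ζ) (0, 1) (0, 1) =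
        totalSnd φ (J 0) (0, 1) (0, 1) - D (0, Complex.I * ζ) := by
      have e1 : (J ζ).lift (0, 1) = (J 0).lift (0, 1) := by simp [J, Jet.lift, Jet.slope]
      have e2 : (J ζ).curv (0, 1) (0, 1) = (J 0).curv (0, 1) (0, 1) + (-1 : ℝ) • (Complex.I * ζ) := by
        simp only [J, Jet.curv_dx, neg_smul, one_smul]
        ring
      rw [totalSnd, e1, e2, clm_snd_add, clm_snd_smul, totalSnd, hD, neg_smul, one_smul,
        ← sub_eq_add_neg, ← add_sub_assoc]
    rw [e, hbz] at h1
    simp only [Prod.fst_sub, Prod.snd_sub, sub_smul] at h1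
    simp only [B, smul_sub]
    linear_combination h1 - h0
  have hB : ∀ ζ, c ^ 2 • (Complex.I * B ζ) = τ • B (Complex.I * ζ) := by
    intro ζ
    have h1 := heq ζ
    have h2 := hBt ζ
    have h3 := hBx ζ
    rw [← h2, ← neg_eq_iff_eq_neg.mpr h3]
    simp only [Complex.real_smul]
    linear_combination (c ^ 2 : ℝ) * (τ : ℂ) * h1
  refine ⟨?_, b, hB⟩
  -- If `B 1` vanished, a nonzero vertical vector would be mapped into the tangent plane of the
  -- image graph.
  have hB1 : B 1 ≠ 0 := by
    intro h
    have h1 := (hK 0).vertical_eq_zero hφ.1 (δ := 1) (by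
      have h0 : (D (0, 1)).1.1 = 0 := ht z hz 0 1
      change (K 0).slope (D (0, 1)).1 = (D (0, 1)).2
      rw [Jet.slope, h0, zero_smul, zero_add]
      exact (sub_eq_zero.mp h).symm)
    exact one_ne_zero h1
  have h1 := hB 1
  have h2 := hB (Complex.I * 1)
  have h3 : B (Complex.I * (Complex.I * 1)) = -B 1 := by
    have e : Complex.I * (Complex.I * 1) = (-1 : ℝ) • (1 : ℂ) := by
      rw [← mul_assoc, Complex.I_mul_I]; simp
    simp only [B, e, clm_snd_smul, Prod.smul_fst, Prod.smul_snd, smul_eq_mul]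
    module
  rw [h3] at h2
  have h4 : ((c ^ 2) ^ 2 - τ ^ 2 : ℝ) • B 1 = 0 := by
    simp only [Complex.real_smul] at h1 h2 ⊢
    push_cast at h1 h2 ⊢
    linear_combination (-(c : ℂ) ^ 2 * Complex.I) * h1 - (τ : ℂ) * h2
      - (c : ℂ) ^ 4 * B 1 * Complex.I_mul_I.symm
  have h5 : (c ^ 2) ^ 2 = τ ^ 2 := sub_eq_zero.mp ((smul_eq_zero.mp h4).resolve_right hB1)
  rw [← abs_of_nonneg (sq_nonneg c)]
  exact (sq_eq_sq_iff_abs_eq_abs _ _).mp h5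

/-- For `η` in an open set, `c(η)` is affine and `c(η) (c(η)² - |τ|) = 0`; the case `c = 0` is
included, where `admissible_scale` does not apply. An affine function satisfying this cubic equation
is constant, so the new `x` is independent of `ψ`. Then the correction by `b` disappears from the
relation on fibres. -/
theorem admissible_isReduced (hφ : φ ∈ admissible F F') {z : Base} (hz : z ∈ φ.source) :
    IsReduced (fderiv ℝ φ z) := by
  have hinj := hφ.1.fderiv_injective hz
  have ht := admissible_time_eq_zero hφ hz
  have hτ := fderiv_time_ne_zero hinj ht
  obtain ⟨η₀, hU⟩ := exists_dom_nhds hφ hz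
  have hη₀ := mem_of_mem_nhds hU
  have hroot : ∀ η, (z, η) ∈ F.dom → (fderiv ℝ φ z ((0, 1), η)).1.2 *
      ((fderiv ℝ φ z ((0, 1), η)).1.2 ^ 2 - |(fderiv ℝ φ z ((1, 0), 0)).1.1|) = 0 := by
    intro η hη
    by_cases hc : (fderiv ℝ φ z ((0, 1), η)).1.2 = 0
    · rw [hc, zero_mul]
    · rw [(admissible_scale hφ hz hη hc).1, sub_self, mul_zero]
  have hs : ∀ δ, (fderiv ℝ φ z (0, δ)).1.2 = 0 := by
    intro δ
    obtain ⟨h, hh, hmem⟩ := exists_segment_mem hU δ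
    have e : ∀ s : ℝ, (fderiv ℝ φ z ((0, 1), η₀ + (s * h) • δ)).1.2 =
        (fderiv ℝ φ z ((0, 1), η₀)).1.2 + s * (h * (fderiv ℝ φ z (0, δ)).1.2) := by
      intro s
      rw [clm_snd_add, clm_snd_smul]
      simp [mul_assoc]
    have p0 := hroot _ (hmem 0 (by norm_num) (by norm_num))
    have p1 := hroot _ (hmem 1 (by norm_num) (by norm_num))
    have p2 := hroot _ (hmem 2 (by norm_num) (by norm_num))
    have p3 := hroot _ (hmem 3 (by norm_num) (by norm_num))
    rw [e] at p0 p1 p2 p3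
    -- The third difference of a cubic polynomial is six times its leading coefficient, here the
    -- cube of the slope of `c`.
    have h6 : (h * (fderiv ℝ φ z (0, δ)).1.2) ^ 3 = 0 := by
      linear_combination (p3 - 3 * p2 + 3 * p1 - p0) / 6
    exact (mul_eq_zero.mp (pow_eq_zero_iff (by norm_num) |>.mp h6)).resolve_left hh.ne'
  have hc : (fderiv ℝ φ z ((0, 1), η₀)).1.2 = (fderiv ℝ φ z ((0, 1), 0)).1.2 := by
    have e : (((0, 1), η₀) : Base) = ((0, 1), 0 + η₀) := by simp
    rw [e, clm_snd_add, Prod.fst_add, Prod.snd_add, hs, add_zero]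
  have hne := fderiv_space_ne_zero hinj ht hs
  obtain ⟨hsc, b, hb⟩ := admissible_scale hφ hz hη₀ (by rw [hc]; exact hne)
  refine ⟨ht, hs, hτ, by rw [← hc]; exact hsc, fun ζ => ?_⟩
  have h1 := hb ζ
  rw [hsc, hs, hs, zero_smul, sub_zero, sub_zero] at h1
  refine smul_right_injective ℂ hτ ?_
  change _ • _ = _ • _
  rw [← h1, smul_smul]
  congr 1
  set τ := (fderiv ℝ φ z ((1, 0), 0)).1.1
  have : |τ| ≠ 0 := abs_ne_zero.mpr hτ
  field_simp
  exact sq_abs τ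

end

/-! ### Transformations with reduced differentials -/

namespace IsReduced

variable {D D' : Base →L[ℝ] Base}

theorem apply_vertical (h : IsReduced D) (η : ℂ) : D (0, η) = (0, (D (0, η)).2) :=
  Prod.ext (Prod.ext (h.time 0 η) (h.space η)) rfl

theorem apply_time (h : IsReduced D) (w : Base) :
    (D w).1.1 = w.1.1 * (D ((1, 0), 0)).1.1 := by
  have h0 : (D (0, w.2)).1.1 = 0 := h.time 0 w.2
  rw [clm_base_apply]
  simp [h0, h.time]

theorem apply_space (h : IsReduced D) (w : Base) :
    (D w).1.2 = w.1.1 * (D ((1, 0), 0)).1.2 + w.1.2 * (D ((0, 1), 0)).1.2 := by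
  rw [clm_base_apply]
  simp [h.space]

theorem space_ne (h : IsReduced D) : (D ((0, 1), 0)).1.2 ≠ 0 := by
  intro h0
  have := h.scale
  rw [h0, zero_pow two_ne_zero, eq_comm, abs_eq_zero] at this
  exact h.time_ne this

theorem div_abs_mul_self {τ : ℝ} (hτ : τ ≠ 0) : τ / |τ| * (τ / |τ|) = 1 := by
  have := abs_ne_zero.mpr hτ
  field_simp
  exact (sq_abs τ).symm

theorem id : IsReduced (ContinuousLinearMap.id ℝ Base) := by
  constructor <;> simp

/-- Both vertical parts are complex linear or antilinear, and the signs of the time scalings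
multiply just as the types of linearity do. -/
theorem comp (h' : IsReduced D') (h : IsReduced D) : IsReduced (D'.comp D) := by
  have e1 : ((D'.comp D) ((1, 0), 0)).1.1 = (D ((1, 0), 0)).1.1 * (D' ((1, 0), 0)).1.1 := by
    rw [ContinuousLinearMap.comp_apply, h'.apply_time]
  have e2 : ((D'.comp D) ((0, 1), 0)).1.2 = (D ((0, 1), 0)).1.2 * (D' ((0, 1), 0)).1.2 := by
    rw [ContinuousLinearMap.comp_apply, h'.apply_space, h.time, zero_mul, zero_add]
  refine ⟨fun y η => ?_, fun η => ?_, ?_, ?_, fun η => ?_⟩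
  · rw [ContinuousLinearMap.comp_apply, h'.apply_time, h.time, zero_mul]
  · rw [ContinuousLinearMap.comp_apply, h.apply_vertical, h'.space]
  · rw [e1]
    exact mul_ne_zero h.time_ne h'.time_ne
  · rw [e1, e2, abs_mul, mul_pow, h.scale, h'.scale]
  · rw [e1, ContinuousLinearMap.comp_apply, ContinuousLinearMap.comp_apply, h.apply_vertical,
      h.apply_vertical η, h.conf, clm_snd_smul, Prod.smul_snd, h'.conf, smul_smul, abs_mul,
      mul_div_mul_comm]

theorem inverse (h : IsReduced D) (hD : D.comp D' = ContinuousLinearMap.id ℝ Base)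
    (hD' : D'.comp D = ContinuousLinearMap.id ℝ Base) : IsReduced D' := by
  have r (w : Base) : D (D' w) = w := DFunLike.congr_fun hD w
  have l (w : Base) : D' (D w) = w := DFunLike.congr_fun hD' w
  have ht (w : Base) : (D' w).1.1 * (D ((1, 0), 0)).1.1 = w.1.1 := by rw [← h.apply_time, r]
  have hx (w : Base) : (D' w).1.1 * (D ((1, 0), 0)).1.2 + (D' w).1.2 * (D ((0, 1), 0)).1.2
      = w.1.2 := by rw [← h.apply_space, r]
  have time : ∀ (y : ℝ) (η : ℂ), (D' ((0, y), η)).1.1 = 0 := fun y η =>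
    (mul_eq_zero.mp (ht ((0, y), η))).resolve_right h.time_ne
  have time0 : ∀ η : ℂ, (D' (0, η)).1.1 = 0 := time 0
  have space : ∀ η : ℂ, (D' (0, η)).1.2 = 0 := fun η => by
    have := hx (0, η)
    rw [time0, zero_mul, zero_add] at this
    exact (mul_eq_zero.mp this).resolve_right h.space_ne
  have e1 : (D' ((1, 0), 0)).1.1 = ((D ((1, 0), 0)).1.1)⁻¹ :=
    eq_inv_of_mul_eq_one_left (ht ((1, 0), 0))
  have e2 : (D' ((0, 1), 0)).1.2 = ((D ((0, 1), 0)).1.2)⁻¹ := by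
    have := hx ((0, 1), 0)
    rw [time, zero_mul, zero_add] at this
    exact eq_inv_of_mul_eq_one_left this
  have hs := div_abs_mul_self h.time_ne
  refine ⟨time, space, ?_, ?_, fun η => ?_⟩
  · rw [e1]
    exact inv_ne_zero h.time_ne
  · rw [e1, e2, inv_pow, h.scale, abs_inv]
  · set ζ := (D' (0, η)).2
    set τ := (D ((1, 0), 0)).1.1 with hτ
    have v : D' (0, η) = (0, ζ) := Prod.ext (Prod.ext (time 0 η) (space η)) rfl
    have h1 : (D (0, ζ)).2 = η := by rw [← v, r]
    have h2 : D (0, (τ / |τ|) • (Complex.I * ζ)) = (0, Complex.I * η) := by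
      rw [clm_snd_smul, h.apply_vertical, h.conf, h1, ← hτ, Prod.smul_mk, smul_smul, hs, one_smul,
        smul_zero]
    rw [← h2, l, e1, abs_inv, inv_div_inv]
    refine congrArg (fun r : ℝ => r • (Complex.I * ζ)) ?_
    exact eq_div_of_mul_eq h.time_ne (by
      rw [div_mul_eq_mul_div, ← sq, ← sq_abs, sq, mul_self_div_self])

end IsReduced

/-- A point transformation with reduced differentials. -/
structure IsReducedTransformation (φ : OpenPartialHomeomorph Base Base) : Prop where
  point : IsPointTransformation φ
  reduced : ∀ z ∈ φ.source, IsReduced (fderiv ℝ φ z)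

/-- The linear part `i ψ_t + ψ_xx` of the equations. -/
def Jet.principal (j : Jet) : ℂ := Complex.I * j.2.1.1 + j.2.2.2.2

/-- The jet with the given arguments of the arbitrary element, on the equations whose arbitrary
elements take the value `f` there. -/
def jetAt (a : ArgSpace) (f : ℂ) : Jet := (a.1, (0, a.2), (0, 0, -f))

theorem jetAt_args (a : ArgSpace) (f : ℂ) : (jetAt a f).args = a := rfl

theorem jetAt_principal (a : ArgSpace) (f : ℂ) : (jetAt a f).principal = -f := by
  simp [jetAt, Jet.principal]

theorem mem_equation_iff {F : ArbitraryElement} {j : Jet} :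
    j ∈ F.equation ↔ j.args ∈ F.dom ∧ j.principal = -F.toFun j.args :=
  and_congr_right fun _ => (eq_neg_iff_add_eq_zero (a := j.principal)).symm

/-- The second prolongation of a transformation with reduced differentials. -/
def prolong (φ : Base → Base) (j : Jet) : Jet :=
  let MT := fderiv ℝ φ j.1 (j.lift (1, 0))
  let MX := fderiv ℝ φ j.1 (j.lift (0, 1))
  let b := MX.1.2⁻¹ • MX.2
  let a := MT.1.1⁻¹ • (MT.2 - MT.1.2 • b)
  let R : Base → ℂ := fun W => W.2 - W.1.1 • a - W.1.2 • b
  let hxx := (MX.1.2 ^ 2)⁻¹ • R (totalSnd φ j (0, 1) (0, 1))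
  let htx := (MX.1.2 * MT.1.1)⁻¹ •
    (R (totalSnd φ j (1, 0) (0, 1)) - (MT.1.2 * MX.1.2) • hxx)
  let htt := (MT.1.1 ^ 2)⁻¹ • (R (totalSnd φ j (1, 0) (1, 0)) - (2 * MT.1.1 * MT.1.2) • htx
    - MT.1.2 ^ 2 • hxx)
  (φ j.1, (a, b), (htt, htx, hxx))

/-! ### Action of reduced transformations on jets and on `i ψ_t + ψ_xx`. -/

section

variable {φ : OpenPartialHomeomorph Base Base} {F F' : ArbitraryElement} {j j' k k' : Jet}

namespace IsReducedTransformation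

theorem symm (h : IsReducedTransformation φ) : IsReducedTransformation φ.symm := by
  refine ⟨h.point.symm, fun z hz => ?_⟩
  have hz' : φ.symm z ∈ φ.source := φ.map_target hz
  have h1 : DifferentiableAt ℝ φ (φ.symm z) := (h.point.contDiffAt hz').differentiableAt (by simp)
  have h2 : DifferentiableAt ℝ φ.symm z :=
    (h.point.symm.contDiffAt hz).differentiableAt (by simp)
  have h2' : DifferentiableAt ℝ φ.symm (φ (φ.symm z)) := by rwa [φ.right_inv hz]
  have e1 : (fun y => φ (φ.symm y)) =ᶠ[𝓝 z] fun y => y := by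
    filter_upwards [φ.open_target.mem_nhds hz] with y hy using φ.right_inv hy
  have e2 : (fun y => φ.symm (φ y)) =ᶠ[𝓝 (φ.symm z)] fun y => y := by
    filter_upwards [φ.open_source.mem_nhds hz'] with y hy using φ.left_inv hy
  have c1 := (h1.hasFDerivAt.comp z h2.hasFDerivAt).unique
    ((hasFDerivAt_id z).congr_of_eventuallyEq e1)
  have c2 := (h2'.hasFDerivAt.comp (φ.symm z) h1.hasFDerivAt).unique
    ((hasFDerivAt_id (φ.symm z)).congr_of_eventuallyEq e2)
  rw [φ.right_inv hz] at c2
  exact (h.reduced _ hz').inverse c1 c2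

theorem trans {ψ : OpenPartialHomeomorph Base Base} (h : IsReducedTransformation φ)
    (h' : IsReducedTransformation ψ) : IsReducedTransformation (φ.trans ψ) := by
  refine ⟨⟨?_, ?_⟩, fun z hz => ?_⟩
  · intro z hz
    rw [OpenPartialHomeomorph.trans_source] at hz
    exact ((h'.point.contDiffAt hz.2).comp z (h.point.contDiffAt hz.1)).contDiffWithinAt
  · intro z hz
    rw [OpenPartialHomeomorph.trans_target] at hz
    exact ((h.point.symm.contDiffAt hz.2).comp z
      (h'.point.symm.contDiffAt hz.1)).contDiffWithinAt
  · rw [OpenPartialHomeomorph.trans_source] at hz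
    have h1 : DifferentiableAt ℝ φ z := (h.point.contDiffAt hz.1).differentiableAt (by simp)
    have h2 : DifferentiableAt ℝ ψ (φ z) :=
      (h'.point.contDiffAt hz.2).differentiableAt (by simp)
    rw [OpenPartialHomeomorph.coe_trans, fderiv_comp z h2 h1]
    exact (h'.reduced _ hz.2).comp (h.reduced _ hz.1)

theorem of_eventuallyEq (h : ∀ z ∈ φ.source, ∃ ψ, IsReducedTransformation ψ ∧ z ∈ ψ.source ∧
    φ =ᶠ[𝓝 z] ψ ∧ φ.symm =ᶠ[𝓝 (φ z)] ψ.symm) : IsReducedTransformation φ := by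
  refine ⟨⟨fun z hz => ?_, fun z' hz' => ?_⟩, fun z hz => ?_⟩
  · obtain ⟨ψ, hψ, hzψ, e, -⟩ := h z hz
    exact ((hψ.point.contDiffAt hzψ).congr_of_eventuallyEq e).contDiffWithinAt
  · obtain ⟨ψ, hψ, hzψ, e, e'⟩ := h (φ.symm z') (φ.map_target hz')
    rw [φ.right_inv hz'] at e'
    have hm : z' ∈ ψ.target := by
      have := ψ.map_source hzψ
      rwa [← e.self_of_nhds, φ.right_inv hz'] at this
    exact ((hψ.point.symm.contDiffAt hm).congr_of_eventuallyEq e').contDiffWithinAt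
  · obtain ⟨ψ, hψ, hzψ, e, -⟩ := h z hz
    rw [e.fderiv_eq]
    exact hψ.reduced z hzψ

theorem refl : IsReducedTransformation (OpenPartialHomeomorph.refl Base) := by
  refine ⟨⟨contDiffOn_id, contDiffOn_id⟩, fun z _ => ?_⟩
  rw [show (OpenPartialHomeomorph.refl Base : Base → Base) = fun y => y from rfl, fderiv_fun_id]
  exact IsReduced.id

theorem of_admissible (hφ : φ ∈ admissible F F') : IsReducedTransformation φ :=
  ⟨hφ.1, fun _ => admissible_isReduced hφ⟩

/-- The new total `x`-direction has no `t`-component, so the slope and curvature identities form a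
triangular system, solved in the order `ψ_x`, `ψ_t`, `ψ_xx`, `ψ_tx`, `ψ_tt`. -/
theorem prolong_eq (h : IsReducedTransformation φ) (hj : Prolongs φ j j') : j' = prolong φ j := by
  have hz := h.reduced _ hj.mem_source
  have sX := hj.slope_eq h.point (0, 1)
  have sT := hj.slope_eq h.point (1, 0)
  have cXX := hj.curv_eq h.point (0, 1) (0, 1)
  have cTX := hj.curv_eq h.point (1, 0) (0, 1)
  have cTT := hj.curv_eq h.point (1, 0) (1, 0)
  have tX : (fderiv ℝ φ j.1 (j.lift (0, 1))).1.1 = 0 := by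
    rw [hz.apply_time]; simp [Jet.lift]
  have tT : (fderiv ℝ φ j.1 (j.lift (1, 0))).1.1 ≠ 0 := by
    rw [hz.apply_time]; simpa [Jet.lift] using hz.time_ne
  have xX : (fderiv ℝ φ j.1 (j.lift (0, 1))).1.2 ≠ 0 := by
    rw [hz.apply_space]; simpa [Jet.lift] using hz.space_ne
  simp only [Jet.slope, Jet.curv, tX, zero_smul, zero_add, mul_zero, zero_mul, add_zero]
    at sX sT cXX cTX cTT
  have eb : j'.2.1.2 = (fderiv ℝ φ j.1 (j.lift (0, 1))).1.2⁻¹ •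
      (fderiv ℝ φ j.1 (j.lift (0, 1))).2 := by
    rw [← sX, inv_smul_smul₀ xX]
  have ea : j'.2.1.1 = (fderiv ℝ φ j.1 (j.lift (1, 0))).1.1⁻¹ •
      ((fderiv ℝ φ j.1 (j.lift (1, 0))).2 -
        (fderiv ℝ φ j.1 (j.lift (1, 0))).1.2 • j'.2.1.2) := by
    rw [← sT, add_sub_cancel_right, inv_smul_smul₀ tT]
  have exx : j'.2.2.2.2 = ((fderiv ℝ φ j.1 (j.lift (0, 1))).1.2 ^ 2)⁻¹ •
      ((totalSnd φ j (0, 1) (0, 1)).2 - (totalSnd φ j (0, 1) (0, 1)).1.1 • j'.2.1.1 -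
        (totalSnd φ j (0, 1) (0, 1)).1.2 • j'.2.1.2) := by
    rw [eq_inv_smul_iff₀ (pow_ne_zero 2 xX), ← cXX, sq]
    abel
  have etx : j'.2.2.2.1 = ((fderiv ℝ φ j.1 (j.lift (0, 1))).1.2 *
      (fderiv ℝ φ j.1 (j.lift (1, 0))).1.1)⁻¹ •
      (((totalSnd φ j (1, 0) (0, 1)).2 - (totalSnd φ j (1, 0) (0, 1)).1.1 • j'.2.1.1 -
        (totalSnd φ j (1, 0) (0, 1)).1.2 • j'.2.1.2) -
        ((fderiv ℝ φ j.1 (j.lift (1, 0))).1.2 * (fderiv ℝ φ j.1 (j.lift (0, 1))).1.2) •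
          j'.2.2.2.2) := by
    rw [eq_inv_smul_iff₀ (mul_ne_zero xX tT), ← cTX]
    module
  have ett : j'.2.2.1 = ((fderiv ℝ φ j.1 (j.lift (1, 0))).1.1 ^ 2)⁻¹ •
      (((totalSnd φ j (1, 0) (1, 0)).2 - (totalSnd φ j (1, 0) (1, 0)).1.1 • j'.2.1.1 -
        (totalSnd φ j (1, 0) (1, 0)).1.2 • j'.2.1.2) -
        (2 * (fderiv ℝ φ j.1 (j.lift (1, 0))).1.1 * (fderiv ℝ φ j.1 (j.lift (1, 0))).1.2) •
          j'.2.2.2.1 - (fderiv ℝ φ j.1 (j.lift (1, 0))).1.2 ^ 2 • j'.2.2.2.2) := by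
    rw [eq_inv_smul_iff₀ (pow_ne_zero 2 tT), ← cTT]
    module
  rw [etx, exx, ea, eb] at ett
  rw [exx, ea, eb] at etx
  rw [ea, eb] at exx
  rw [eb] at ea
  exact Prod.ext hj.apply_eq.symm (Prod.ext (Prod.ext ea eb)
    (Prod.ext ett (Prod.ext etx exx)))

/-- For reduced differentials the transversality condition is automatic, so the prolongation is
defined at every jet over the source. -/
theorem prolongs_iff (h : IsReducedTransformation φ) :
    Prolongs φ j j' ↔ j.1 ∈ φ.source ∧ j' = prolong φ j := by
  refine ⟨fun hj => ⟨hj.mem_source, h.prolong_eq hj⟩, fun ⟨hj, he⟩ => ?_⟩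
  have hz := h.reduced _ hj
  obtain ⟨k, hk⟩ := exists_prolongs h.point hj (fun ξ hξ => by
    have h1 := congrArg Prod.fst hξ
    have h2 := congrArg Prod.snd hξ
    rw [hz.apply_time] at h1
    rw [hz.apply_space] at h2
    simp only [Jet.lift, Prod.fst_zero, Prod.snd_zero] at h1 h2
    have h3 := (mul_eq_zero.mp h1).resolve_right hz.time_ne
    rw [h3, zero_mul, zero_add] at h2
    exact Prod.ext h3 ((mul_eq_zero.mp h2).resolve_right hz.space_ne))
  rw [he, ← h.prolong_eq hk]
  exact hk

theorem prolongs_prolong (h : IsReducedTransformation φ) (hj : j.1 ∈ φ.source) :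
    Prolongs φ j (prolong φ j) := h.prolongs_iff.mpr ⟨hj, rfl⟩

/-- The new `ψ_x` does not involve `ψ_t`, because the new `t` depends on `t` only. -/
theorem args_congr (h : IsReducedTransformation φ) (hj : Prolongs φ j j') (hk : Prolongs φ k k')
    (he : j.args = k.args) : j'.args = k'.args := by
  have hz := h.reduced _ hj.mem_source
  have e0 : j.1 = k.1 := congrArg (fun a : ArgSpace => a.1) he
  have e1 : j.2.1.2 = k.2.1.2 := congrArg (fun a : ArgSpace => a.2) he
  have tj := (hj.triangular h.point fun z hz => (h.reduced z hz).time).1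
  have tk := (hk.triangular h.point fun z hz => (h.reduced z hz).time).1
  rw [← e0, ← e1, ← tj] at tk
  refine Prod.ext ?_ (smul_right_injective ℂ ?_ tk).symm
  · change j'.1 = k'.1
    rw [← hj.apply_eq, ← hk.apply_eq, e0]
  · rw [hz.apply_space]
    simpa using hz.space_ne

/-- The `ψ_t`-difference scales by `τ` and the `ψ_xx`-difference by `c² = |τ|`. Pulling `i` through
the vertical differential costs the factor `τ / |τ|`, which makes the two scalings equal. This is
the reason why the class is preserved. -/
theorem principal_sub (h : IsReducedTransformation φ) (hj : Prolongs φ j j')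
    (hk : Prolongs φ k k') (he : j.args = k.args) :
    |(fderiv ℝ φ j.1 ((1, 0), 0)).1.1| • (j'.principal - k'.principal) =
      (fderiv ℝ φ j.1 (0, j.principal - k.principal)).2 := by
  have hz := h.reduced _ hj.mem_source
  have e0 : j.1 = k.1 := congrArg (fun a : ArgSpace => a.1) he
  have e1 : j.2.1.2 = k.2.1.2 := congrArg (fun a : ArgSpace => a.2) he
  have e1' : j'.2.1.2 = k'.2.1.2 := congrArg (fun a : ArgSpace => a.2) (h.args_congr hj hk he)
  obtain ⟨-, tj, xj⟩ := hj.triangular h.point fun z hz => (h.reduced z hz).time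
  obtain ⟨-, tk, xk⟩ := hk.triangular h.point fun z hz => (h.reduced z hz).time
  set D := fderiv ℝ φ j.1 with hD
  rw [← e0, ← e1, ← hD, ← e1'] at xk
  rw [← e0, ← hD, ← e1'] at tk
  have hc : (D ((0, 1), j.2.1.2)).1.2 = (D ((0, 1), 0)).1.2 := by
    rw [hz.apply_space]; simp
  rw [hc, hz.scale] at xj xk
  have hT : D ((1, 0), j.2.1.1) = D ((1, 0), k.2.1.1) + D (0, j.2.1.1 - k.2.1.1) := by
    rw [← clm_snd_add, add_sub_cancel]
  have hW : totalSnd φ j (0, 1) (0, 1) =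
      totalSnd φ k (0, 1) (0, 1) + D (0, j.2.2.2.2 - k.2.2.2.2) := by
    have hl : j.lift (0, 1) = k.lift (0, 1) := by simp [Jet.lift, Jet.slope, e1]
    rw [totalSnd, totalSnd, hl, Jet.curv_dx, Jet.curv_dx, ← e0, ← hD, add_assoc, ← clm_snd_add,
      add_sub_cancel]
  rw [hT, hz.apply_vertical] at tj
  rw [hW, hz.apply_vertical] at xj
  simp only [Prod.fst_add, Prod.snd_add, add_zero] at tj xj
  have hp : j.principal - k.principal =
      Complex.I * (j.2.1.1 - k.2.1.1) + (j.2.2.2.2 - k.2.2.2.2) := by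
    simp only [Jet.principal]; ring
  rw [hp, clm_snd_add, Prod.snd_add, hz.conf]
  set τ := (D ((1, 0), 0)).1.1 with hτ
  have ht : (D (0, j.2.1.1 - k.2.1.1)).2 = τ • (j'.2.1.1 - k'.2.1.1) := by
    rw [smul_sub]; linear_combination tk - tj
  have hx : (D (0, j.2.2.2.2 - k.2.2.2.2)).2 = |τ| • (j'.2.2.2.2 - k'.2.2.2.2) := by
    rw [smul_sub]; linear_combination xk - xj
  have hττ : |τ| = τ / |τ| * τ := by
    have := abs_ne_zero.mpr hz.time_ne
    rw [← hτ] at this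
    field_simp
    exact sq_abs τ
  rw [ht, hx, mul_smul_comm, smul_smul, ← hττ, ← smul_add]
  congr 1
  simp only [Jet.principal]
  ring

/-- Over given arguments, the image of `i ψ_t + ψ_xx` depends on its value alone and determines it.
So the action on values of `F` is well defined and invertible. -/
theorem principal_eq_iff (h : IsReducedTransformation φ) (hj : Prolongs φ j j')
    (hk : Prolongs φ k k') (he : j.args = k.args) :
    j'.principal = k'.principal ↔ j.principal = k.principal := by
  have hz := h.reduced _ hj.mem_source
  have hs := h.principal_sub hj hk he
  constructor
  · intro e
    rw [e, sub_self, smul_zero] at hs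
    have h0 : fderiv ℝ φ j.1 (0, j.principal - k.principal) = fderiv ℝ φ j.1 0 := by
      rw [hz.apply_vertical, ← hs, map_zero]; rfl
    have := congrArg Prod.snd (h.point.fderiv_injective hj.mem_source h0)
    exact sub_eq_zero.mp this
  · intro e
    rw [e, sub_self] at hs
    have h0 : fderiv ℝ φ j.1 (0, 0) = 0 := map_zero (fderiv ℝ φ j.1)
    rw [h0] at hs
    exact sub_eq_zero.mp ((smul_eq_zero.mp hs).resolve_left (abs_ne_zero.mpr hz.time_ne))

end IsReducedTransformation

end

/-! ### The equivalence group -/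

theorem contDiffAt_fderiv_apply {E G : Type*} [NormedAddCommGroup E] [NormedSpace ℝ E]
    [NormedAddCommGroup G] [NormedSpace ℝ G] {g h : G → E} {x : G}
    {H : Type*} [NormedAddCommGroup H] [NormedSpace ℝ H] {f : E → H}
    (hf : ContDiffAt ℝ ∞ f (g x)) (hg : ContDiffAt ℝ ∞ g x) (hh : ContDiffAt ℝ ∞ h x) :
    ContDiffAt ℝ ∞ (fun y => fderiv ℝ f (g y) (h y)) x :=
  ContDiffAt.clm_apply (ContDiffAt.comp x (hf.fderiv_right (m := ∞) le_rfl) hg) hh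

theorem contDiffAt_lift (ξ : ℝ × ℝ) (j : Jet) : ContDiffAt ℝ ∞ (fun j : Jet => j.lift ξ) j := by
  unfold Jet.lift Jet.slope
  fun_prop

theorem contDiffAt_totalSnd {φ : Base → Base} {j : Jet} (h : ContDiffAt ℝ ∞ φ j.1)
    (ξ η : ℝ × ℝ) : ContDiffAt ℝ ∞ (fun j : Jet => totalSnd φ j ξ η) j := by
  have h1 : ContDiffAt ℝ ∞ (fun j : Jet => ((0, j.curv ξ η) : Base)) j := by
    unfold Jet.curv
    fun_prop
  have h2 := contDiffAt_fderiv_apply (h.fderiv_right (m := ∞) le_rfl) contDiffAt_fst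
    (contDiffAt_lift ξ j)
  exact (h2.clm_apply (contDiffAt_lift η j)).add (contDiffAt_fderiv_apply h contDiffAt_fst h1)

theorem contDiffAt_prolong {φ : Base → Base} {j : Jet} (h : ContDiffAt ℝ ∞ φ j.1)
    (hr : IsReduced (fderiv ℝ φ j.1)) : ContDiffAt ℝ ∞ (prolong φ) j := by
  have hT := contDiffAt_fderiv_apply h contDiffAt_fst (contDiffAt_lift (1, 0) j)
  have hX := contDiffAt_fderiv_apply h contDiffAt_fst (contDiffAt_lift (0, 1) j)
  have tT : (fderiv ℝ φ j.1 (j.lift (1, 0))).1.1 ≠ 0 := by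
    rw [hr.apply_time]; simpa [Jet.lift] using hr.time_ne
  have xX : (fderiv ℝ φ j.1 (j.lift (0, 1))).1.2 ≠ 0 := by
    rw [hr.apply_space]; simpa [Jet.lift] using hr.space_ne
  have hτ := hT.fst.fst
  have hκ := hT.fst.snd
  have hc := hX.fst.snd
  have hb := (hc.inv xX).smul hX.snd
  have ha := (hτ.inv tT).smul (hT.snd.sub (hκ.smul hb))
  have hR (ξ η : ℝ × ℝ) := ((contDiffAt_totalSnd h ξ η).snd.sub
    ((contDiffAt_totalSnd h ξ η).fst.fst.smul ha)).sub
      ((contDiffAt_totalSnd h ξ η).fst.snd.smul hb)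
  have hxx := ((hc.pow 2).inv (pow_ne_zero 2 xX)).smul (hR (0, 1) (0, 1))
  have htx := ((hc.mul hτ).inv (mul_ne_zero xX tT)).smul
    ((hR (1, 0) (0, 1)).sub ((hκ.mul hc).smul hxx))
  have htt := ((hτ.pow 2).inv (pow_ne_zero 2 tT)).smul
    (((hR (1, 0) (1, 0)).sub ((((contDiffAt_const (c := (2 : ℝ))).mul hτ).mul hκ).smul htx)).sub
      ((hκ.pow 2).smul hxx))
  exact (ContDiffAt.comp j h contDiffAt_fst).prodMk
    ((ha.prodMk hb).prodMk (htt.prodMk (htx.prodMk hxx)))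

section

variable {φ : OpenPartialHomeomorph Base Base} {F F' : ArbitraryElement} {j j' k k' : Jet}

/-- The action of a transformation with reduced differentials on jets and values of the arbitrary
element. -/
def prolongWithValue (φ : Base → Base) (q : Jet × ℂ) : Jet × ℂ :=
  (prolong φ q.1, -(prolong φ (jetAt q.1.args q.2)).principal)

theorem contDiff_jetAt : ContDiff ℝ ∞ (fun a : ArgSpace × ℂ => jetAt a.1 a.2) := by
  unfold jetAt
  fun_prop

theorem contDiff_principal : ContDiff ℝ ∞ Jet.principal := by
  unfold Jet.principal
  fun_prop

theorem contDiff_args : ContDiff ℝ ∞ Jet.args := by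
  unfold Jet.args
  fun_prop

namespace IsReducedTransformation

theorem contDiffAt_prolong (h : IsReducedTransformation φ) (hj : j.1 ∈ φ.source) :
    ContDiffAt ℝ ∞ (prolong φ) j :=
  SchrodingerClass.contDiffAt_prolong (h.point.contDiffAt hj) (h.reduced _ hj)

theorem contDiffAt_prolongWithValue (h : IsReducedTransformation φ) {q : Jet × ℂ}
    (hq : q.1.1 ∈ φ.source) : ContDiffAt ℝ ∞ (prolongWithValue φ) q := by
  have h1 : ContDiffAt ℝ ∞ (fun q : Jet × ℂ => prolong φ q.1) q :=
    (h.contDiffAt_prolong hq).comp q contDiffAt_fst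
  have h2 : ContDiffAt ℝ ∞ (fun q : Jet × ℂ => jetAt q.1.args q.2) q :=
    (contDiff_jetAt.comp ((contDiff_args.comp contDiff_fst).prodMk contDiff_snd)).contDiffAt
  have h3 : ContDiffAt ℝ ∞ (fun q : Jet × ℂ => prolong φ (jetAt q.1.args q.2)) q :=
    ContDiffAt.comp q (g := prolong φ) (h.contDiffAt_prolong (j := jetAt q.1.args q.2) hq) h2
  exact h1.prodMk (contDiff_principal.contDiffAt.comp q h3).neg

theorem prolong_symm_prolong (h : IsReducedTransformation φ) (hj : j.1 ∈ φ.source) :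
    prolong φ.symm (prolong φ j) = j :=
  (h.symm.prolong_eq ((h.prolongs_prolong hj).symm h.point)).symm

/-- The value component may be computed from any jet with the right arguments and the right `i ψ_t +
ψ_xx`. The representative `jetAt` chosen at the image need not be the image of the original one, and
`principal_eq_iff` for `φ.symm` makes up for that. -/
theorem prolongWithValue_symm (h : IsReducedTransformation φ) {q : Jet × ℂ}
    (hq : q.1.1 ∈ φ.source) : prolongWithValue φ.symm (prolongWithValue φ q) = q := by
  refine Prod.ext (h.prolong_symm_prolong hq) ?_
  have h1 := h.prolongs_prolong hq
  have h2 := h.prolongs_prolong (j := jetAt q.1.args q.2) hq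
  have ha := h.args_congr h1 h2 rfl
  have hm : (prolong φ q.1).1 ∈ φ.symm.source := by
    rw [← h1.apply_eq]; exact φ.map_source hq
  set f := -(prolong φ (jetAt q.1.args q.2)).principal with hf
  have h3 := h.symm.prolongs_prolong (j := jetAt (prolong φ q.1).args f) hm
  have h4 := (h.symm.principal_eq_iff h3 (h2.symm h.point) ha).mpr (by
    rw [jetAt_principal, hf, neg_neg])
  change -(prolong φ.symm (jetAt (prolong φ q.1).args f)).principal = q.2
  rw [h4, jetAt_principal, neg_neg]

/-- The equivalence transformation induced by a transformation with reduced differentials. -/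
def equivalence (h : IsReducedTransformation φ) :
    OpenPartialHomeomorph (Jet × ℂ) (Jet × ℂ) where
  toFun := prolongWithValue φ
  invFun := prolongWithValue φ.symm
  source := {q | q.1.1 ∈ φ.source}
  target := {q | q.1.1 ∈ φ.target}
  map_source' q hq := φ.map_source hq
  map_target' q hq := φ.map_target hq
  left_inv' q hq := h.prolongWithValue_symm hq
  right_inv' q hq := by simpa using h.symm.prolongWithValue_symm hq
  open_source := φ.open_source.preimage (by fun_prop)
  open_target := φ.open_target.preimage (by fun_prop)
  continuousOn_toFun q hq := (h.contDiffAt_prolongWithValue hq).continuousAt.continuousWithinAt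
  continuousOn_invFun q hq :=
    (h.symm.contDiffAt_prolongWithValue hq).continuousAt.continuousWithinAt

theorem isPointTransformation_equivalence (h : IsReducedTransformation φ) :
    IsPointTransformation h.equivalence :=
  ⟨fun _ hq => (h.contDiffAt_prolongWithValue hq).contDiffWithinAt,
    fun _ hq => (h.symm.contDiffAt_prolongWithValue hq).contDiffWithinAt⟩

theorem restrictsTo_equivalence (h : IsReducedTransformation φ) :
    RestrictsTo h.equivalence φ := by
  refine ⟨?_, ?_, fun q hq => h.prolongs_prolong hq⟩
  · ext q
    exact ⟨fun hq => ⟨_, h.prolongs_prolong hq⟩, fun ⟨_, hj⟩ => hj.mem_source⟩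
  · ext q
    refine ⟨fun hq => ⟨_, (prolongs_symm_iff h.point).mp (h.symm.prolongs_prolong hq)⟩, ?_⟩
    rintro ⟨j, hj⟩
    change q.1.1 ∈ φ.target
    rw [← hj.apply_eq]
    exact φ.map_source hj.mem_source

/-- A transformation of the jets and the values of the arbitrary element that matches an
admissible transformation maps the arbitrary elements to each other. -/
theorem isImage (h : IsReducedTransformation φ) {Ψ : OpenPartialHomeomorph (Jet × ℂ) (Jet × ℂ)}
    (hΨ : RestrictsTo Ψ φ)
    (hv : ∀ q ∈ Ψ.source, (Ψ q).2 = -(prolong φ (jetAt q.1.args q.2)).principal)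
    (hφ : φ ∈ admissible F F') : IsImage Ψ F F' := by
  intro q hq
  have h1 := hΨ.2.2 q hq
  have h2 := h.prolongs_prolong (j := jetAt q.1.args q.2) h1.mem_source
  have h3 := hφ.2.2.2 _ _ h2
  rw [mem_equation_iff, mem_equation_iff, jetAt_args, jetAt_principal, neg_inj,
    ← h.args_congr h1 h2 rfl, ← neg_neg (prolong φ (jetAt q.1.args q.2)).principal, ← hv q hq,
    neg_inj] at h3
  exact h3

/-- The image of an arbitrary element under a transformation with reduced differentials. -/
def image (h : IsReducedTransformation φ) (F : ArbitraryElement) : ArbitraryElement where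
  -- The value `0` in `jetAt y 0` is a dummy: by `args_congr` the arguments of the preimage do not
  -- depend on it.
  dom := {y | y.1 ∈ φ.target} ∩ (fun y => (prolong φ.symm (jetAt y 0)).args) ⁻¹' F.dom
  isOpen_dom := by
    refine ContinuousOn.isOpen_inter_preimage ?_ (φ.open_target.preimage (by fun_prop)) F.isOpen_dom
    intro y hy
    have h1 : ContDiffAt ℝ ∞ (fun y : ArgSpace => jetAt y 0) y :=
      (contDiff_jetAt.comp (contDiff_id.prodMk contDiff_const)).contDiffAt
    have h2 := ContDiffAt.comp y (g := prolong φ.symm)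
      (h.symm.contDiffAt_prolong (j := jetAt y 0) hy) h1
    exact (contDiff_args.contDiffAt.comp y h2).continuousAt.continuousWithinAt
  toFun y := -(prolong φ (jetAt (prolong φ.symm (jetAt y 0)).args
    (F.toFun (prolong φ.symm (jetAt y 0)).args))).principal
  smooth := by
    intro y hy
    have h1 : ContDiffAt ℝ ∞ (fun y : ArgSpace => jetAt y 0) y :=
      (contDiff_jetAt.comp (contDiff_id.prodMk contDiff_const)).contDiffAt
    have h2 := contDiff_args.contDiffAt.comp y (ContDiffAt.comp y (g := prolong φ.symm)
      (h.symm.contDiffAt_prolong (j := jetAt y 0) hy.1) h1)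
    have h3 := ContDiffAt.comp y (F.smooth.contDiffAt (F.isOpen_dom.mem_nhds hy.2)) h2
    have h4 := contDiff_jetAt.contDiffAt.comp y (h2.prodMk h3)
    have h5 : (prolong φ.symm (jetAt y 0)).1 ∈ φ.source := φ.map_target hy.1
    have h6 := ContDiffAt.comp y (g := prolong φ) (h.contDiffAt_prolong (j := jetAt
      (prolong φ.symm (jetAt y 0)).args (F.toFun (prolong φ.symm (jetAt y 0)).args)) h5) h4
    exact (contDiff_principal.contDiffAt.comp y h6).neg.contDiffWithinAt

/-- Membership in the equation is tested against the jet with the same arguments and with value `F`;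
`principal_eq_iff` shows that this comparison is preserved in both directions. -/
theorem admissible_image (h : IsReducedTransformation φ) (hF : φ.source ⊆ F.region) :
    φ ∈ admissible F (h.image F) := by
  have hargs : ∀ j j', Prolongs φ j j' → (prolong φ.symm (jetAt j'.args 0)).args = j.args := by
    intro j j' hj
    have hm : j'.1 ∈ φ.target := by rw [← hj.apply_eq]; exact φ.map_source hj.mem_source
    exact h.symm.args_congr (h.symm.prolongs_prolong (j := jetAt j'.args 0) hm)
      (hj.symm h.point) rfl
  have htarget : ∀ j j', Prolongs φ j j' → j'.1 ∈ φ.target := fun j j' hj => by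
    rw [← hj.apply_eq]; exact φ.map_source hj.mem_source
  have hdom : ∀ j j', Prolongs φ j j' → (j'.args ∈ (h.image F).dom ↔ j.args ∈ F.dom) := by
    intro j j' hj
    change (_ ∧ (prolong φ.symm (jetAt j'.args 0)).args ∈ F.dom) ↔ _
    rw [hargs j j' hj]
    exact and_iff_right (htarget j j' hj)
  refine ⟨h.point, hF, fun z' hz' => ?_, fun j j' hj => ?_⟩
  · obtain ⟨a, ha, haz⟩ := hF (φ.map_target hz')
    have hm : (jetAt a 0).1 ∈ φ.source := by
      change a.1 ∈ φ.source
      rw [haz]; exact φ.map_target hz'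
    have h1 := h.prolongs_prolong hm
    refine ⟨(prolong φ (jetAt a 0)).args, (hdom _ _ h1).mpr ha, ?_⟩
    change φ a.1 = z'
    rw [haz, φ.right_inv hz']
  · rw [mem_equation_iff, mem_equation_iff, hdom j j' hj]
    refine and_congr_right fun _ => ?_
    have h2 := h.prolongs_prolong (j := jetAt j.args (F.toFun j.args)) hj.mem_source
    have h3 := h.principal_eq_iff hj h2 rfl
    rw [jetAt_principal] at h3
    rw [← h3]
    change _ ↔ j'.principal = -(-(prolong φ (jetAt (prolong φ.symm (jetAt j'.args 0)).args
      (F.toFun (prolong φ.symm (jetAt j'.args 0)).args))).principal)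
    rw [hargs j j' hj, neg_neg]

theorem isEquivalenceTransformation (h : IsReducedTransformation φ)
    {Ψ : OpenPartialHomeomorph (Jet × ℂ) (Jet × ℂ)} (hp : IsPointTransformation Ψ)
    (hΨ : RestrictsTo Ψ φ)
    (hv : ∀ q ∈ Ψ.source, (Ψ q).2 = -(prolong φ (jetAt q.1.args q.2)).principal) :
    IsEquivalenceTransformation Ψ φ :=
  ⟨hp, h.point, hΨ, fun F hF => ⟨h.image F, h.isImage hΨ hv (h.admissible_image hF),
    h.admissible_image hF⟩⟩

theorem isEquivalenceTransformation_equivalence (h : IsReducedTransformation φ) :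
    IsEquivalenceTransformation h.equivalence φ :=
  h.isEquivalenceTransformation h.isPointTransformation_equivalence h.restrictsTo_equivalence
    fun _ _ => rfl

end IsReducedTransformation

/-- The arbitrary element with a constant value. -/
def constantElement (f : ℂ) : ArbitraryElement := ⟨univ, isOpen_univ, fun _ => f, contDiffOn_const⟩

theorem subset_region_constantElement (f : ℂ) (s : Set Base) : s ⊆ (constantElement f).region :=
  fun z _ => ⟨(z, 0), mem_univ _, rfl⟩

/-- The zero element is defined everywhere, so admissibility from this single equation already
yields the reduced conditions. -/
theorem IsEquivalenceTransformation.isReducedTransformation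
    {Ψ : OpenPartialHomeomorph (Jet × ℂ) (Jet × ℂ)} (h : IsEquivalenceTransformation Ψ φ) :
    IsReducedTransformation φ := by
  obtain ⟨F', -, hF'⟩ := h.2.2.2 _ (subset_region_constantElement 0 _)
  exact .of_admissible hF'

/-- The graph of the constant element with value `q.2` passes through `q`, so its image determines
the value component of `Ψ` at `q`. Thus `Ψ` is determined by `φ`. -/
theorem IsEquivalenceTransformation.apply_snd {Ψ : OpenPartialHomeomorph (Jet × ℂ) (Jet × ℂ)}
    (h : IsEquivalenceTransformation Ψ φ) {q : Jet × ℂ} (hq : q ∈ Ψ.source) :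
    (Ψ q).2 = -(prolong φ (jetAt q.1.args q.2)).principal := by
  have hr := h.isReducedTransformation
  obtain ⟨-, -, hΨ, hF⟩ := h
  obtain ⟨F', him, hF'⟩ := hF _ (subset_region_constantElement q.2 _)
  have h1 := hΨ.2.2 q hq
  have h2 := hr.prolongs_prolong (j := jetAt q.1.args q.2) h1.mem_source
  have h3 := ((him q hq).mp ⟨mem_univ _, rfl⟩).2
  have h4 := (mem_equation_iff.mp ((hF'.2.2.2 _ _ h2).mp
    (mem_equation_iff.mpr ⟨mem_univ _, jetAt_principal _ _⟩))).2
  rw [h4, neg_neg, h3, hr.args_congr h1 h2 rfl]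

theorem isNormalized : IsNormalized := fun _ _ _ hφ =>
  have h := IsReducedTransformation.of_admissible hφ
  ⟨h.equivalence, h.isEquivalenceTransformation_equivalence,
    h.isImage h.restrictsTo_equivalence (fun _ _ => rfl) hφ⟩

/-! ### The pseudogroup generated by the point symmetries -/

theorem equivalenceGroupOnBase_eq :
    equivalenceGroupOnBase = {φ | IsReducedTransformation φ} :=
  Set.ext fun _ => ⟨fun ⟨_, h⟩ => h.isReducedTransformation,
    fun h => ⟨_, h.isEquivalenceTransformation_equivalence⟩⟩

/-- The pseudogroup of the transformations with reduced differentials. -/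
def reducedGroupoid : StructureGroupoid Base where
  members := {φ | IsReducedTransformation φ}
  trans' _ _ h h' := h.trans h'
  symm' _ h := h.symm
  id_mem' := .refl
  locality' φ h := .of_eventuallyEq fun z hz => by
    obtain ⟨s, hs, hzs, hφ⟩ := h z hz
    have h0 : z ∈ (φ.restr s).source := by rw [φ.restr_source' s hs]; exact ⟨hz, hzs⟩
    exact ⟨φ.restr s, hφ, h0, Filter.EventuallyEq.rfl, Filter.EventuallyEq.rfl⟩
  mem_of_eqOnSource' φ ψ h e := .of_eventuallyEq fun z hz => by
    have hz' : z ∈ φ.source := by rw [← e.source_eq]; exact hz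
    refine ⟨φ, h, hz', ?_, ?_⟩
    · filter_upwards [ψ.open_source.mem_nhds hz] with y hy using e.eqOn hy
    · filter_upwards [ψ.open_target.mem_nhds (ψ.map_source hz)] with y hy using
        e.symm_eqOn_target hy

/-- The arbitrary element that vanishes over the source of `φ` and is the image of zero over the
target of `φ`. -/
def IsReducedTransformation.gluedElement (h : IsReducedTransformation φ)
    (hd : Disjoint φ.source φ.target) : ArbitraryElement where
  dom := {a | a.1 ∈ φ.source} ∪ (h.image (constantElement 0)).dom
  isOpen_dom := (φ.open_source.preimage (by fun_prop)).union (h.image _).isOpen_dom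
  toFun := open scoped Classical in
    fun a => if a.1 ∈ φ.source then 0 else (h.image (constantElement 0)).toFun a
  smooth := by
    intro a ha
    refine ContDiffAt.contDiffWithinAt ?_
    rcases ha with ha | ha
    · refine (contDiffAt_const (c := (0 : ℂ))).congr_of_eventuallyEq ?_
      have : {a : ArgSpace | a.1 ∈ φ.source} ∈ 𝓝 a :=
        (φ.open_source.preimage (by fun_prop)).mem_nhds ha
      filter_upwards [this] with b hb using if_pos hb
    · have hm := (h.image (constantElement 0)).isOpen_dom.mem_nhds ha
      refine ((h.image (constantElement 0)).smooth.contDiffAt hm).congr_of_eventuallyEq ?_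
      filter_upwards [hm] with b hb
      exact if_neg fun hb' => Set.disjoint_left.mp hd hb' hb.1

/-- Disjointness lets the two equations related by `φ` be prescribed independently, so an admissible
transformation between them becomes a symmetry of the single glued equation. -/
theorem IsReducedTransformation.mem_symmetries (h : IsReducedTransformation φ)
    (hd : Disjoint φ.source φ.target) : φ ∈ symmetries (h.gluedElement hd) := by
  have hF := h.admissible_image (subset_region_constantElement 0 φ.source)
  refine ⟨h.point, fun z hz => ⟨(z, 0), Or.inl hz, rfl⟩, fun z hz => ?_, fun j j' hj => ?_⟩
  · obtain ⟨a, ha, haz⟩ := hF.2.2.1 hz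
    exact ⟨a, Or.inr ha, haz⟩
  · have hs := hj.mem_source
    have ht : j'.1 ∉ φ.source := by
      rw [← hj.apply_eq]
      exact Set.disjoint_right.mp hd (φ.map_source hs)
    have h1 := hF.2.2.2 j j' hj
    rw [mem_equation_iff, mem_equation_iff] at h1 ⊢
    have e1 : (h.gluedElement hd).toFun j.args = 0 := if_pos hs
    have e2 : (h.gluedElement hd).toFun j'.args = (h.image (constantElement 0)).toFun j'.args :=
      if_neg ht
    have d1 : j.args ∈ (h.gluedElement hd).dom := Or.inl hs
    have d2 : j'.args ∈ (h.gluedElement hd).dom ↔ j'.args ∈ (h.image (constantElement 0)).dom :=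
      or_iff_right ht
    rw [e1, e2, d2, ← h1]
    exact and_congr_left fun _ => iff_of_true d1 (mem_univ _)

/-- The restriction of a member of the pseudogroup generated by the symmetries near a point that
it moves. -/
theorem IsReducedTransformation.exists_restr_mem (h : IsReducedTransformation φ) {z : Base}
    (hz : z ∈ φ.source) (hne : φ z ≠ z) : ∃ s : Set Base, IsOpen s ∧ z ∈ s ∧
      ∀ t ⊆ s, IsOpen t → φ.restr t ∈ ⋃ F : ArbitraryElement, symmetries F := by
  obtain ⟨U, V, hU, hV, hzU, hzV, hUV⟩ := t2_separation hne
  -- The points of this set lie in `V` and their images in `U`; as `U` and `V` are disjoint, every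
  -- restriction to an open subset has disjoint source and target.
  refine ⟨φ.source ∩ φ ⁻¹' U ∩ V, (φ.isOpen_inter_preimage hU).inter hV, ⟨⟨hz, hzU⟩, hzV⟩,
    fun t ht hto => ?_⟩
  have hr : IsReducedTransformation (φ.restr t) := .of_eventuallyEq fun y hy => by
    rw [φ.restr_source' t hto] at hy
    exact ⟨φ, h, hy.1, Filter.EventuallyEq.rfl, Filter.EventuallyEq.rfl⟩
  refine mem_iUnion.mpr ⟨_, hr.mem_symmetries ?_⟩
  rw [Set.disjoint_left]
  intro y hy hy'
  rw [φ.restr_source' t hto] at hy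
  have h1 := (φ.restr t).map_target hy'
  rw [φ.restr_source' t hto] at h1
  have h2 : φ ((φ.restr t).symm y) = y := (φ.restr t).right_inv hy'
  have h3 := (ht h1.2).1.2
  rw [mem_preimage, h2] at h3
  exact Set.disjoint_left.mp hUV h3 (ht hy.2).2

/-- The shift of `t`. -/
def timeShift (c : ℝ) : OpenPartialHomeomorph Base Base :=
  (Homeomorph.addRight (((c, 0), 0) : Base)).toOpenPartialHomeomorph

theorem isReducedTransformation_timeShift (c : ℝ) : IsReducedTransformation (timeShift c) := by
  refine ⟨⟨?_, ?_⟩, fun z _ => ?_⟩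
  · exact (contDiff_id.add contDiff_const).contDiffOn
  · exact (contDiff_id.sub contDiff_const).contDiffOn
  · have : HasFDerivAt (timeShift c) (ContinuousLinearMap.id ℝ Base) z :=
      (hasFDerivAt_id z).add_const _
    rw [this.fderiv]
    exact .id

theorem timeShift_apply_ne {c : ℝ} (hc : c ≠ 0) (z : Base) : timeShift c z ≠ z := by
  intro h
  have := congrArg (fun w : Base => w.1.1) h
  simp [timeShift, hc] at this

end

/-- Membership in a pseudogroup is local. At a fixed point, `φ` is written as `φ` followed by a time
shift, followed by the inverse shift; both factors move the points in question, so both are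
symmetries after restriction. -/
theorem IsReducedTransformation.mem_of_symmetries {G : StructureGroupoid Base}
    (hG : (⋃ F : ArbitraryElement, symmetries F) ⊆ G.members)
    {φ : OpenPartialHomeomorph Base Base} (h : IsReducedTransformation φ) : φ ∈ G.members := by
  refine G.locality' φ fun z hz => ?_
  by_cases hne : φ z = z
  · let τ := timeShift 1
    have hτ : IsReducedTransformation τ := isReducedTransformation_timeShift 1
    obtain ⟨s₁, ho₁, hz₁, hs₁⟩ := (h.trans hτ).exists_restr_mem (z := z)
      (by rw [OpenPartialHomeomorph.trans_source]; exact ⟨hz, mem_univ _⟩)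
      (by
        change timeShift 1 (φ z) ≠ z
        rw [hne]; exact timeShift_apply_ne one_ne_zero z)
    obtain ⟨s₂, ho₂, hz₂, hs₂⟩ := hτ.symm.exists_restr_mem (z := τ z) (mem_univ _) (by
      rw [τ.left_inv (mem_univ z)]
      exact (timeShift_apply_ne one_ne_zero z).symm)
    have hso : IsOpen (φ.source ∩ (fun y => τ (φ y)) ⁻¹' s₂) := by
      refine ContinuousOn.isOpen_inter_preimage ?_ φ.open_source ho₂
      exact (Homeomorph.continuous _).comp_continuousOn φ.continuousOn
    set s := s₁ ∩ (φ.source ∩ (fun y => τ (φ y)) ⁻¹' s₂)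
    have hsO : IsOpen s := ho₁.inter hso
    refine ⟨s, hsO, ⟨hz₁, hz, by rw [mem_preimage, hne]; exact hz₂⟩, ?_⟩
    have h1 := G.trans' _ _ (hG (hs₁ s inter_subset_left hsO)) (hG (hs₂ s₂ subset_rfl ho₂))
    refine G.mem_of_eqOnSource' _ _ h1 ⟨?_, ?_⟩
    · ext y
      simp only [OpenPartialHomeomorph.trans_source, OpenPartialHomeomorph.restr_source' _ _ hsO,
        OpenPartialHomeomorph.restr_source' _ _ ho₂]
      refine ⟨fun hy => ⟨⟨⟨hy.1, mem_univ _⟩, hy.2⟩, mem_univ _, hy.2.2.2⟩,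
        fun hy => ⟨hy.1.1.1, hy.1.2⟩⟩
    · intro y _
      exact (τ.left_inv (mem_univ (φ y))).symm
  · obtain ⟨s, ho, hzs, hs⟩ := h.exists_restr_mem hz hne
    exact ⟨s, ho, hzs, hG (hs s subset_rfl ho)⟩

theorem generatedPseudogroup_symmetries :
    (generatedPseudogroup (⋃ F : ArbitraryElement, symmetries F)).members =
      {φ | IsReducedTransformation φ} := by
  refine Set.Subset.antisymm ?_ fun φ (hφ : IsReducedTransformation φ) => ?_
  · have h : generatedPseudogroup (⋃ F : ArbitraryElement, symmetries F) ≤ reducedGroupoid :=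
      sInf_le (iUnion_subset fun F φ hφ => IsReducedTransformation.of_admissible hφ)
    exact h
  · exact mem_iInter₂.mpr fun G hG => hφ.mem_of_symmetries hG

theorem isStronglyNormalized : IsStronglyNormalized :=
  ⟨isNormalized, equivalenceGroupOnBase_eq.trans generatedPseudogroup_symmetries.symm⟩

/-! ### The explicit transformations -/

/-- The hat as a real-linear map. -/
def hatCLM (ε' : ℝ) : ℂ →L[ℝ] ℂ :=
  if 0 < ε' then ContinuousLinearMap.id ℝ ℂ else (Complex.conjCLE : ℂ →L[ℝ] ℂ)

theorem hat_eq_hatCLM (ε' : ℝ) (β : ℂ) : hat ε' β = hatCLM ε' β := by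
  unfold hat hatCLM
  split_ifs <;> rfl

theorem hat_hat (ε' : ℝ) (β : ℂ) : hat ε' (hat ε' β) = β := by
  unfold hat
  split_ifs <;> simp

theorem hat_I_mul {ε' : ℝ} (h : ε' = 1 ∨ ε' = -1) (β : ℂ) :
    hat ε' (Complex.I * β) = ε' * (Complex.I * hat ε' β) := by
  rcases h with rfl | rfl
  · simp [hat]
  · have : ¬ (0 : ℝ) < -1 := by norm_num
    simp [hat, this]

/-- The map `(t, x, ψ) ↦ (t, x, w)`, where `w` is the hatted `ψ`. -/
def hatBase (ε' : ℝ) : Base →L[ℝ] Base :=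
  (ContinuousLinearMap.fst ℝ (ℝ × ℝ) ℂ).prod
    ((hatCLM ε').comp (ContinuousLinearMap.snd ℝ (ℝ × ℝ) ℂ))

theorem hatBase_apply (ε' : ℝ) (z : Base) : hatBase ε' z = (z.1, hat ε' z.2) := by
  rw [hat_eq_hatCLM]
  rfl

theorem hatBase_mem {ε' : ℝ} {N : Set Base} {z : Base} (hz : z ∈ N) :
    hatBase ε' z ∈ hatSet ε' N := by
  rw [hatBase_apply]
  change (z.1, hat ε' (hat ε' z.2)) ∈ N
  rw [hat_hat]
  exact hz

theorem isOpen_hatSet (ε' : ℝ) {N : Set Base} (hN : IsOpen N) : IsOpen (hatSet ε' N) := by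
  have : hatSet ε' N = hatBase ε' ⁻¹' N := by
    ext y
    rw [mem_preimage, hatBase_apply]
    rfl
  rw [this]
  exact hN.preimage (hatBase ε').continuous

theorem isOpen_image_time {N : Set Base} (hN : IsOpen N) :
    IsOpen ((fun z : Base => z.1.1) '' N) :=
  (isOpenMap_fst.comp isOpenMap_fst) N hN

/-- The function `Φ` of three variables as a function on the space of `(t, x, w)`. -/
def uncurryBase (Φ : ℝ → ℝ → ℂ → ℂ) (y : Base) : ℂ := Φ y.1.1 y.1.2 y.2

theorem fderiv_fderiv_congr {E G : Type*} [NormedAddCommGroup E] [NormedSpace ℝ E]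
    [NormedAddCommGroup G] [NormedSpace ℝ G] {f g : E → G} {x : E} (h : f =ᶠ[𝓝 x] g) :
    fderiv ℝ (fderiv ℝ f) x = fderiv ℝ (fderiv ℝ g) x :=
  (Filter.EventuallyEq.fderiv h).fderiv_eq

namespace IsParameterSystem

variable {N : Set Base} {T X : ℝ → ℝ} {ε ε' : ℝ} {Φ : ℝ → ℝ → ℂ → ℂ} {z y : Base}

theorem contDiffAt_T (h : IsParameterSystem N T X ε ε' Φ) (hN : IsOpen N) (hz : z ∈ N) :
    ContDiffAt ℝ ∞ T z.1.1 :=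
  h.smooth_T.contDiffAt ((isOpen_image_time hN).mem_nhds (mem_image_of_mem _ hz))

theorem contDiffAt_X (h : IsParameterSystem N T X ε ε' Φ) (hN : IsOpen N) (hz : z ∈ N) :
    ContDiffAt ℝ ∞ X z.1.1 :=
  h.smooth_X.contDiffAt ((isOpen_image_time hN).mem_nhds (mem_image_of_mem _ hz))

theorem contDiffAt_Φ (h : IsParameterSystem N T X ε ε' Φ) (hN : IsOpen N)
    (hy : y ∈ hatSet ε' N) : ContDiffAt ℝ ∞ (uncurryBase Φ) y :=
  h.smooth_Φ.contDiffAt ((isOpen_hatSet ε' hN).mem_nhds hy)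

theorem deriv_T_ne (h : IsParameterSystem N T X ε ε' Φ) (hz : z ∈ N) : deriv T z.1.1 ≠ 0 := by
  intro h0
  have := h.sign_T z hz
  rw [h0, mul_zero] at this
  exact lt_irrefl _ this

theorem abs_deriv_T (h : IsParameterSystem N T X ε ε' Φ) (hz : z ∈ N) :
    |deriv T z.1.1| = ε' * deriv T z.1.1 := by
  have := h.sign_T z hz
  rcases h.eps' with rfl | rfl
  · rw [one_mul] at *
    exact abs_of_pos this
  · rw [neg_one_mul] at *
    exact abs_of_neg (neg_pos.mp this)

/-- Near `z` the absolute value is a constant sign times `T_t`, so the root can be differentiated.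
-/
theorem sqrt_eventuallyEq (h : IsParameterSystem N T X ε ε' Φ) (hN : IsOpen N) (hz : z ∈ N) :
    (fun s => Real.sqrt |deriv T s|) =ᶠ[𝓝 z.1.1] fun s => Real.sqrt (ε' * deriv T s) := by
  filter_upwards [(isOpen_image_time hN).mem_nhds (mem_image_of_mem _ hz)] with s hs
  obtain ⟨z', hz', rfl⟩ := hs
  rw [h.abs_deriv_T hz']

theorem hasDerivAt_sqrt (h : IsParameterSystem N T X ε ε' Φ) (hN : IsOpen N) (hz : z ∈ N) :
    HasDerivAt (fun s => Real.sqrt |deriv T s|)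
      (ε' * deriv (deriv T) z.1.1 / (2 * Real.sqrt |deriv T z.1.1|)) z.1.1 := by
  have h1 : ContDiffAt ℝ ∞ (deriv T) z.1.1 :=
    (h.contDiffAt_T hN hz).derivWithin (m := ∞) le_rfl
  have h2 := (h1.differentiableAt (by simp)).hasDerivAt.const_mul ε'
  have h3 := (h2.sqrt (h.sign_T z hz).ne').congr_of_eventuallyEq (h.sqrt_eventuallyEq hN hz)
  rw [h.abs_deriv_T hz]
  exact h3

theorem contDiffAt_sqrt (h : IsParameterSystem N T X ε ε' Φ) (hN : IsOpen N) (hz : z ∈ N) :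
    ContDiffAt ℝ ∞ (fun s => Real.sqrt |deriv T s|) z.1.1 := by
  have h1 : ContDiffAt ℝ ∞ (deriv T) z.1.1 :=
    (h.contDiffAt_T hN hz).derivWithin (m := ∞) le_rfl
  exact ((contDiffAt_const.mul h1).sqrt (h.sign_T z hz).ne').congr_of_eventuallyEq
    (h.sqrt_eventuallyEq hN hz)

/-- Holomorphy turns the real differential in `w` into multiplication by `Φ_w`. -/
theorem fderiv_Φ_vertical (h : IsParameterSystem N T X ε ε' Φ) (hN : IsOpen N)
    (hy : y ∈ hatSet ε' N) (κ : ℂ) :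
    fderiv ℝ (uncurryBase Φ) y (0, κ) = deriv (Φ y.1.1 y.1.2) y.2 * κ := by
  have h1 : HasFDerivAt (fun w : ℂ => ((y.1, w) : Base))
      (ContinuousLinearMap.inr ℝ (ℝ × ℝ) ℂ) y.2 := hasFDerivAt_prodMk_right y.1 y.2
  have h2 : HasFDerivAt (uncurryBase Φ) (fderiv ℝ (uncurryBase Φ) y) (y.1, y.2) :=
    ((h.contDiffAt_Φ hN hy).differentiableAt (by simp)).hasFDerivAt
  have h3 := h2.comp y.2 h1
  have h4 := (h.holomorphic y hy).hasDerivAt.hasFDerivAt.restrictScalars ℝ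
  have h5 := DFunLike.congr_fun (h3.unique h4) κ
  simpa [mul_comm] using h5

theorem fderiv_Φ_x (h : IsParameterSystem N T X ε ε' Φ) (hN : IsOpen N)
    (hy : y ∈ hatSet ε' N) :
    fderiv ℝ (uncurryBase Φ) y ((0, 1), 0) = deriv (fun x => Φ y.1.1 x y.2) y.1.2 := by
  have h1 : HasDerivAt (fun x : ℝ => (((y.1.1, x), y.2) : Base)) ((0, 1), 0) y.1.2 :=
    ((hasDerivAt_const _ _).prodMk (hasDerivAt_id _)).prodMk (hasDerivAt_const _ _)
  have h2 : HasFDerivAt (uncurryBase Φ) (fderiv ℝ (uncurryBase Φ) y) ((y.1.1, y.1.2), y.2) :=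
    ((h.contDiffAt_Φ hN hy).differentiableAt (by simp)).hasFDerivAt
  exact (h2.comp_hasDerivAt y.1.2 h1).deriv.symm

theorem fderiv_Φ_t (h : IsParameterSystem N T X ε ε' Φ) (hN : IsOpen N)
    (hy : y ∈ hatSet ε' N) :
    fderiv ℝ (uncurryBase Φ) y ((1, 0), 0) = deriv (fun s => Φ s y.1.2 y.2) y.1.1 := by
  have h1 : HasDerivAt (fun s : ℝ => (((s, y.1.2), y.2) : Base)) ((1, 0), 0) y.1.1 :=
    ((hasDerivAt_id _).prodMk (hasDerivAt_const _ _)).prodMk (hasDerivAt_const _ _)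
  have h2 : HasFDerivAt (uncurryBase Φ) (fderiv ℝ (uncurryBase Φ) y) ((y.1.1, y.1.2), y.2) :=
    ((h.contDiffAt_Φ hN hy).differentiableAt (by simp)).hasFDerivAt
  exact (h2.comp_hasDerivAt y.1.1 h1).deriv.symm

/-- The formula for the vertical derivative holds on an open set and can be differentiated again in
`x` and in `w`; the symmetry of second derivatives merges the two mixed terms. -/
theorem fderiv_fderiv_Φ (h : IsParameterSystem N T X ε ε' Φ) (hN : IsOpen N)
    (hy : y ∈ hatSet ε' N) (κ : ℂ) :
    fderiv ℝ (fderiv ℝ (uncurryBase Φ)) y ((0, 1), κ) ((0, 1), κ) =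
      deriv (fun x => deriv (fun x' => Φ y.1.1 x' y.2) x) y.1.2 +
        2 * deriv (fun x => deriv (Φ y.1.1 x) y.2) y.1.2 * κ +
        deriv (deriv (Φ y.1.1 y.1.2)) y.2 * κ ^ 2 := by
  have hΦ : ContDiffAt ℝ 2 (uncurryBase Φ) y := (h.contDiffAt_Φ hN hy).of_le two_le_infty
  have hnhds := (isOpen_hatSet ε' hN).mem_nhds hy
  have hD (v : Base) : HasFDerivAt (fun q => fderiv ℝ (uncurryBase Φ) q v)
      (fderiv ℝ (fun q => fderiv ℝ (uncurryBase Φ) q v) y) ((y.1.1, y.1.2), y.2) :=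
    ((differentiableAt_fderiv hΦ).clm_apply (differentiableAt_const v)).hasFDerivAt
  have h1 : HasDerivAt (fun x : ℝ => (((y.1.1, x), y.2) : Base)) ((0, 1), 0) y.1.2 :=
    ((hasDerivAt_const _ _).prodMk (hasDerivAt_id _)).prodMk (hasDerivAt_const _ _)
  have h2 : HasFDerivAt (fun w : ℂ => ((y.1, w) : Base))
      (ContinuousLinearMap.inr ℝ (ℝ × ℝ) ℂ) y.2 := hasFDerivAt_prodMk_right y.1 y.2
  have hx : ∀ᶠ x in 𝓝 y.1.2, (((y.1.1, x), y.2) : Base) ∈ hatSet ε' N :=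
    h1.continuousAt.eventually hnhds
  have hw : ∀ᶠ w in 𝓝 y.2, ((y.1, w) : Base) ∈ hatSet ε' N :=
    h2.continuousAt.eventually hnhds
  have exx : fderiv ℝ (fderiv ℝ (uncurryBase Φ)) y ((0, 1), 0) ((0, 1), 0) =
      deriv (fun x => deriv (fun x' => Φ y.1.1 x' y.2) x) y.1.2 := by
    have h3 := (hD ((0, 1), 0)).comp_hasDerivAt y.1.2 h1
    rw [← fderiv_fderiv_apply hΦ, ← h3.deriv]
    refine Filter.EventuallyEq.deriv_eq ?_
    filter_upwards [hx] with x hx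
    exact h.fderiv_Φ_x hN hx
  have exw : fderiv ℝ (fderiv ℝ (uncurryBase Φ)) y ((0, 1), 0) (0, κ) =
      deriv (fun x => deriv (Φ y.1.1 x) y.2) y.1.2 * κ := by
    have h3 := (hD (0, 1)).comp_hasDerivAt y.1.2 h1
    have h4 : deriv (fun x => deriv (Φ y.1.1 x) y.2) y.1.2 =
        fderiv ℝ (fun q => fderiv ℝ (uncurryBase Φ) q (0, 1)) y ((0, 1), 0) := by
      rw [← h3.deriv]
      refine Filter.EventuallyEq.deriv_eq ?_
      filter_upwards [hx] with x hx
      refine Eq.trans ?_ (h.fderiv_Φ_vertical hN hx 1).symm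
      exact (mul_one _).symm
    have h5 : (fun q => fderiv ℝ (uncurryBase Φ) q (0, κ)) =ᶠ[𝓝 y]
        fun q => fderiv ℝ (uncurryBase Φ) q (0, 1) * κ := by
      filter_upwards [hnhds] with q hq
      rw [h.fderiv_Φ_vertical hN hq, h.fderiv_Φ_vertical hN hq, mul_one]
    rw [← fderiv_fderiv_apply hΦ, h5.fderiv_eq, h4, ((hD (0, 1)).mul_const' κ).fderiv]
    simp [mul_comm]
  have eww : fderiv ℝ (fderiv ℝ (uncurryBase Φ)) y (0, κ) (0, κ) =
      deriv (deriv (Φ y.1.1 y.1.2)) y.2 * κ ^ 2 := by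
    have h5 : (fun q => fderiv ℝ (uncurryBase Φ) q (0, κ)) =ᶠ[𝓝 y]
        fun q => fderiv ℝ (uncurryBase Φ) q (0, 1) * κ := by
      filter_upwards [hnhds] with q hq
      rw [h.fderiv_Φ_vertical hN hq, h.fderiv_Φ_vertical hN hq, mul_one]
    have h3 := (hD (0, 1)).comp y.2 h2
    have hopen : IsOpen {w : ℂ | ((y.1, w) : Base) ∈ hatSet ε' N} :=
      (isOpen_hatSet ε' hN).preimage (by fun_prop)
    have hhol : DifferentiableOn ℂ (Φ y.1.1 y.1.2) {w : ℂ | ((y.1, w) : Base) ∈ hatSet ε' N} :=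
      fun w hw => (h.holomorphic _ hw).differentiableWithinAt
    have h4 := (((hhol.deriv hopen).differentiableAt
      (hopen.mem_nhds hy)).hasDerivAt.hasFDerivAt.restrictScalars ℝ)
    have h6 : ((fun q => fderiv ℝ (uncurryBase Φ) q (0, 1)) ∘ fun w : ℂ => ((y.1, w) : Base))
        =ᶠ[𝓝 y.2] deriv (Φ y.1.1 y.1.2) := by
      filter_upwards [hw] with w hw
      exact (h.fderiv_Φ_vertical hN hw 1).trans (mul_one _)
    have h7 := DFunLike.congr_fun (h3.unique (h4.congr_of_eventuallyEq h6)) κ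
    simp only [ContinuousLinearMap.comp_apply, ContinuousLinearMap.inr_apply] at h7
    rw [← fderiv_fderiv_apply hΦ, h5.fderiv_eq, ((hD (0, 1)).mul_const' κ).fderiv]
    simp only [smul_apply, h7, ContinuousLinearMap.coe_restrictScalars',
      MulOpposite.smul_eq_mul_unop, MulOpposite.unop_op]
    simp
    ring
  have e : (((0, 1), κ) : Base) = ((0, 1), 0) + (0, κ) := by simp
  rw [e]
  simp only [map_add, add_apply]
  rw [fderiv_fderiv_symm hΦ (0, κ) ((0, 1), 0), exx, exw, eww]
  ring

end IsParameterSystem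

/-- The chain-rule relations solved for the new derivatives, with `r = √|T_t|`, `S = T_tt`, `Y =
X_t`, `e = ε`, `e' = ε'`, and `b`, `a`, `h` the new `ψ_x`, `ψ_t`, `ψ_xx`. The old `F` is replaced by
`-(i ψ_t + ψ_xx)`, whose hatted value is `-(e' i wt + wxx)`. -/
theorem newF_algebra {r e e' x S Y : ℝ} {b a h wt wx wxx Φt Φx Φw Φxx Φxw Φww : ℂ} (hr : r ≠ 0)
    (he : e = 1 ∨ e = -1) (he' : e' = 1 ∨ e' = -1)
    (h1 : (e * r) • b = Φx + Φw * wx)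
    (h2 : (e' * r ^ 2) • a + (e * x * (e' * S / (2 * r)) + Y) • b = Φt + Φw * wt)
    (h3 : (r ^ 2) • h = Φxx + 2 * Φxw * wx + Φww * wx ^ 2 + Φw * wxx) :
    ((1 / r ^ 2 : ℝ) : ℂ) * (Φw * (-(e' * (Complex.I * wt) + wxx)) - Complex.I * (e' : ℂ) * Φt
      + Complex.I * ((S / (2 * r ^ 2) * x + e * e' * Y / r : ℝ) : ℂ) * (Φx + Φw * wx)
      - Φxx - 2 * Φxw * wx - Φww * wx ^ 2) = -(Complex.I * a + h) := by
  have hrC : (r : ℂ) ≠ 0 := by exact_mod_cast hr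
  simp only [Complex.real_smul] at h1 h2 h3
  have hΦt : Φt = ((e' * r ^ 2 : ℝ) : ℂ) * a + ((e * x * (e' * S / (2 * r)) + Y : ℝ) : ℂ) * b
      - Φw * wt := by rw [h2]; ring
  have hΦxx : Φxx = ((r ^ 2 : ℝ) : ℂ) * h - 2 * Φxw * wx - Φww * wx ^ 2 - Φw * wxx := by
    rw [h3]; ring
  rw [← h1, hΦt, hΦxx]
  rcases he with rfl | rfl <;> rcases he' with rfl | rfl <;>
  · push_cast
    field_simp
    ring

namespace IsParameterSystem

variable {N : Set Base} {T X : ℝ → ℝ} {ε ε' : ℝ} {Φ : ℝ → ℝ → ℂ → ℂ} {z : Base}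

theorem newBase_snd : (fun z => (newBase T X ε ε' Φ z).2) =
    fun z => uncurryBase Φ (hatBase ε' z) := by
  ext1 z
  rw [hatBase_apply]
  rfl

theorem contDiffAt_newBase (h : IsParameterSystem N T X ε ε' Φ) (hN : IsOpen N) (hz : z ∈ N) :
    ContDiffAt ℝ ∞ (newBase T X ε ε' Φ) z := by
  have p1 : ContDiffAt ℝ ∞ (fun z : Base => z.1.1) z := by fun_prop
  have p2 : ContDiffAt ℝ ∞ (fun z : Base => z.1.2) z := by fun_prop
  have h1 : ContDiffAt ℝ ∞ (fun z : Base => T z.1.1) z :=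
    ContDiffAt.comp z (h.contDiffAt_T hN hz) p1
  have h2 : ContDiffAt ℝ ∞ (fun z : Base => X z.1.1) z :=
    ContDiffAt.comp z (h.contDiffAt_X hN hz) p1
  have h3 : ContDiffAt ℝ ∞ (fun z : Base => Real.sqrt |deriv T z.1.1|) z :=
    ContDiffAt.comp z (g := fun s => Real.sqrt |deriv T s|) (h.contDiffAt_sqrt hN hz) p1
  have h4 : ContDiffAt ℝ ∞ (fun z => (newBase T X ε ε' Φ z).2) z := by
    rw [newBase_snd]
    exact ContDiffAt.comp z (h.contDiffAt_Φ hN (hatBase_mem hz))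
      (hatBase ε').contDiff.contDiffAt
  exact (h1.prodMk (((contDiffAt_const.mul p2).mul h3).add h2)).prodMk h4

theorem fderiv_newBase (h : IsParameterSystem N T X ε ε' Φ) (hN : IsOpen N) (hz : z ∈ N)
    (v : Base) : fderiv ℝ (newBase T X ε ε' Φ) z v =
      ((deriv T z.1.1 * v.1.1, ε * v.1.2 * Real.sqrt |deriv T z.1.1| +
        (ε * z.1.2 * (ε' * deriv (deriv T) z.1.1 / (2 * Real.sqrt |deriv T z.1.1|)) +
          deriv X z.1.1) * v.1.1),
        fderiv ℝ (uncurryBase Φ) (hatBase ε' z) (hatBase ε' v)) := by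
  have hd := ((h.contDiffAt_newBase hN hz).differentiableAt (by simp)).hasFDerivAt
  have p1 : HasFDerivAt (fun z : Base => z.1.1) ((ContinuousLinearMap.fst ℝ ℝ ℝ).comp
      (ContinuousLinearMap.fst ℝ (ℝ × ℝ) ℂ)) z :=
    ((ContinuousLinearMap.fst ℝ ℝ ℝ).comp (ContinuousLinearMap.fst ℝ (ℝ × ℝ) ℂ)).hasFDerivAt
  have p2 : HasFDerivAt (fun z : Base => z.1.2) ((ContinuousLinearMap.snd ℝ ℝ ℝ).comp
      (ContinuousLinearMap.fst ℝ (ℝ × ℝ) ℂ)) z :=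
    ((ContinuousLinearMap.snd ℝ ℝ ℝ).comp (ContinuousLinearMap.fst ℝ (ℝ × ℝ) ℂ)).hasFDerivAt
  have h1 := (((h.contDiffAt_T hN hz).differentiableAt (by simp)).hasDerivAt).comp_hasFDerivAt z p1
  have h2 := (((h.contDiffAt_X hN hz).differentiableAt (by simp)).hasDerivAt).comp_hasFDerivAt z p1
  have h3 := (h.hasDerivAt_sqrt hN hz).comp_hasFDerivAt z p1
  have h4 := ((p2.const_mul ε).mul h3).add h2
  have h5 : HasFDerivAt (fun z => (newBase T X ε ε' Φ z).2)
      ((fderiv ℝ (uncurryBase Φ) (hatBase ε' z)).comp (hatBase ε')) z := by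
    rw [newBase_snd]
    exact ((h.contDiffAt_Φ hN (hatBase_mem hz)).differentiableAt (by simp)).hasFDerivAt.comp z
      (hatBase ε').hasFDerivAt
  refine Prod.ext (Prod.ext ?_ ?_) ?_
  · exact DFunLike.congr_fun (hd.fst.fst.unique h1) v
  · refine (DFunLike.congr_fun (hd.fst.snd.unique h4) v).trans ?_
    simp
    ring
  · exact DFunLike.congr_fun (hd.snd.unique h5) v

theorem fderiv_newBase_snd (h : IsParameterSystem N T X ε ε' Φ) (hN : IsOpen N) (hz : z ∈ N)
    (η : ℂ) : (fderiv ℝ (newBase T X ε ε' Φ) z (0, η)).2 =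
      deriv (Φ z.1.1 z.1.2) (hat ε' z.2) * hat ε' η := by
  rw [h.fderiv_newBase hN hz]
  change fderiv ℝ (uncurryBase Φ) (hatBase ε' z) (hatBase ε' (0, η)) = _
  rw [hatBase_apply ε' (0, η)]
  refine (h.fderiv_Φ_vertical hN (hatBase_mem hz) _).trans ?_
  rw [hatBase_apply]

theorem isReduced (h : IsParameterSystem N T X ε ε' Φ) (hN : IsOpen N) (hz : z ∈ N) :
    IsReduced (fderiv ℝ (newBase T X ε ε' Φ) z) := by
  have h0 := h.deriv_T_ne hz
  refine ⟨fun y η => ?_, fun η => ?_, ?_, ?_, fun η => ?_⟩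
  · rw [h.fderiv_newBase hN hz]; simp
  · rw [h.fderiv_newBase hN hz]; simp
  · rw [h.fderiv_newBase hN hz]; simpa using h0
  · rw [h.fderiv_newBase hN hz, h.fderiv_newBase hN hz]
    have he : ε ^ 2 = 1 := by rcases h.eps with rfl | rfl <;> norm_num
    simp [mul_pow, he]
  · rw [h.fderiv_newBase_snd hN hz, h.fderiv_newBase_snd hN hz, h.fderiv_newBase hN hz,
      hat_I_mul h.eps']
    have e : deriv T z.1.1 / |deriv T z.1.1| = ε' := by
      rw [div_eq_iff (abs_ne_zero.mpr h0), h.abs_deriv_T hz, ← mul_assoc]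
      rcases h.eps' with rfl | rfl <;> norm_num
    simp only [mul_one, e, Complex.real_smul]
    ring

theorem fderiv_newBase_injective (h : IsParameterSystem N T X ε ε' Φ) (hN : IsOpen N)
    (hz : z ∈ N) : Function.Injective (fderiv ℝ (newBase T X ε ε' Φ) z) := by
  have hr := h.isReduced hN hz
  refine (injective_iff_map_eq_zero _).mpr fun w hw => ?_
  have h1 : w.1.1 = 0 := by
    have := hr.apply_time w
    rw [hw] at this
    exact (mul_eq_zero.mp this.symm).resolve_right hr.time_ne
  have h2 : w.1.2 = 0 := by
    have := hr.apply_space w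
    rw [hw, h1, zero_mul, zero_add] at this
    exact (mul_eq_zero.mp this.symm).resolve_right hr.space_ne
  have h3 : w = (0, w.2) := Prod.ext (Prod.ext h1 h2) rfl
  have h4 := h.fderiv_newBase_snd hN hz w.2
  rw [← h3, hw] at h4
  have h5 : deriv (Φ z.1.1 z.1.2) (hat ε' z.2) ≠ 0 := by
    have := h.deriv_ne_zero _ (hatBase_mem hz)
    rwa [hatBase_apply] at this
  have h6 : hat ε' w.2 = 0 := (mul_eq_zero.mp h4.symm).resolve_left h5
  have h7 : w.2 = 0 := by
    rw [← hat_hat ε' w.2, h6]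
    simp [hat]
  rw [h3, h7]
  rfl

/-- The new `x` is affine in `x` with slope `ε √|T_t|` depending on `t` only, and the new `ψ` is `Φ`
after the real-linear map `hatBase`, so no other second-order terms appear. -/
theorem fderiv_fderiv_newBase (h : IsParameterSystem N T X ε ε' Φ) (hN : IsOpen N) (hz : z ∈ N)
    (η : ℂ) :
    (fderiv ℝ (fderiv ℝ (newBase T X ε ε' Φ)) z ((0, 1), η) ((0, 1), η)).1.2 = 0 ∧
    (fderiv ℝ (fderiv ℝ (newBase T X ε ε' Φ)) z ((0, 1), η) ((0, 1), η)).2 =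
      fderiv ℝ (fderiv ℝ (uncurryBase Φ)) (hatBase ε' z) ((0, 1), hat ε' η)
        ((0, 1), hat ε' η) := by
  have hf : ContDiffAt ℝ 2 (newBase T X ε ε' Φ) z :=
    (h.contDiffAt_newBase hN hz).of_le two_le_infty
  constructor
  · have hD : HasFDerivAt (fun q => fderiv ℝ (newBase T X ε ε' Φ) q ((0, 1), η)) _ z :=
      ((differentiableAt_fderiv hf).clm_apply (differentiableAt_const _)).hasFDerivAt
    have p1 : HasFDerivAt (fun z : Base => z.1.1) ((ContinuousLinearMap.fst ℝ ℝ ℝ).comp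
      (ContinuousLinearMap.fst ℝ (ℝ × ℝ) ℂ)) z :=
    ((ContinuousLinearMap.fst ℝ ℝ ℝ).comp (ContinuousLinearMap.fst ℝ (ℝ × ℝ) ℂ)).hasFDerivAt
    have h3 := ((h.hasDerivAt_sqrt hN hz).comp_hasFDerivAt z p1).const_mul ε
    have h4 : (fun q => (fderiv ℝ (newBase T X ε ε' Φ) q ((0, 1), η)).1.2) =ᶠ[𝓝 z]
        fun q => ε * ((fun s => Real.sqrt |deriv T s|) ∘ fun q : Base => q.1.1) q := by
      filter_upwards [hN.mem_nhds hz] with q hq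
      rw [h.fderiv_newBase hN hq]
      simp
    have h5 := DFunLike.congr_fun (hD.fst.snd.unique (h3.congr_of_eventuallyEq h4)) ((0, 1), η)
    rw [← fderiv_fderiv_apply hf]
    refine h5.trans ?_
    simp
  · have h1 := fderiv_fderiv_clm_comp (ContinuousLinearMap.snd ℝ (ℝ × ℝ) ℂ) hf
      ((0, 1), η) ((0, 1), η)
    simp only [ContinuousLinearMap.coe_snd', newBase_snd] at h1
    rw [← h1, fderiv_fderiv_comp ((h.contDiffAt_Φ hN (hatBase_mem hz)).of_le two_le_infty)
      (hatBase ε').contDiff.contDiffAt]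
    have e : fderiv ℝ (hatBase ε') = fun _ => hatBase ε' := by
      ext1 y; exact (hatBase ε').fderiv
    rw [e]
    simp [hatBase_apply]

/-- Both the old and the new `F` can be read off as minus `i ψ_t + ψ_xx`, so the formula for the new
`F` reduces to the prolongation formulas. -/
theorem newF_eq (h : IsParameterSystem N T X ε ε' Φ) (hN : IsOpen N)
    {φ : OpenPartialHomeomorph Base Base} (hφ : IsReducedTransformation φ) {k k' : Jet}
    (hz : k.1 ∈ N) (he : φ =ᶠ[𝓝 k.1] newBase T X ε ε' Φ) (hk : Prolongs φ k k') :
    newF T X ε ε' Φ k (-k.principal) = -k'.principal := by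
  obtain ⟨h1, h2, h3⟩ := hk.triangular hφ.point fun z hz => (hφ.reduced z hz).time
  have lX : k.lift (0, 1) = ((0, 1), k.2.1.2) := by rw [Jet.lift, Jet.slope_dx]
  have hm := hatBase_mem (ε' := ε') hz
  have hr : Real.sqrt |deriv T k.1.1.1| ≠ 0 :=
    (Real.sqrt_pos.mpr (abs_pos.mpr (h.deriv_T_ne hz))).ne'
  obtain ⟨d1, d2⟩ := h.fderiv_fderiv_newBase hN hz k.2.1.2
  have hA : |deriv T k.1.1.1| = Real.sqrt |deriv T k.1.1.1| ^ 2 :=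
    (Real.sq_sqrt (abs_nonneg _)).symm
  have hT : deriv T k.1.1.1 = ε' * Real.sqrt |deriv T k.1.1.1| ^ 2 := by
    rw [← hA, h.abs_deriv_T hz, ← mul_assoc]
    rcases h.eps' with rfl | rfl <;> norm_num
  have hW : totalSnd φ k (0, 1) (0, 1) =
      fderiv ℝ (fderiv ℝ (newBase T X ε ε' Φ)) k.1 ((0, 1), k.2.1.2) ((0, 1), k.2.1.2) +
        fderiv ℝ (newBase T X ε ε' Φ) k.1 (0, k.2.2.2.2) := by
    rw [totalSnd, lX, Jet.curv_dx, he.fderiv_eq, fderiv_fderiv_congr he]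
  have hW1 : (totalSnd φ k (0, 1) (0, 1)).1.2 = 0 := by
    rw [hW, Prod.fst_add, Prod.snd_add, d1, (h.isReduced hN hz).space, add_zero]
  have hv (s y : ℝ) (η : ℂ) : fderiv ℝ (uncurryBase Φ) (hatBase ε' k.1) (hatBase ε' ((s, y), η)) =
      s • deriv (fun s => Φ s k.1.1.2 (hat ε' k.1.2)) k.1.1.1 +
      y • deriv (fun y => Φ k.1.1.1 y (hat ε' k.1.2)) k.1.1.2 +
      deriv (Φ k.1.1.1 k.1.1.2) (hat ε' k.1.2) * hat ε' η := by
    rw [hatBase_apply ε' ((s, y), η), clm_base_apply, h.fderiv_Φ_t hN hm, h.fderiv_Φ_x hN hm,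
      h.fderiv_Φ_vertical hN hm, hatBase_apply]
  rw [hW1, zero_smul, add_zero, hW, Prod.snd_add, d2, h.fderiv_fderiv_Φ hN hm,
    h.fderiv_newBase_snd hN hz, hatBase_apply] at h3
  rw [he.fderiv_eq] at h1 h2 h3
  simp only [h.fderiv_newBase hN hz, hv] at h1 h2 h3
  have hc : ε ^ 2 = 1 := by rcases h.eps with rfl | rfl <;> norm_num
  have hp : hat ε' (-k.principal) =
      -(ε' * (Complex.I * hat ε' k.2.1.1) + hat ε' k.2.2.2.2) := by
    rw [← hat_I_mul h.eps', hat_eq_hatCLM, hat_eq_hatCLM, hat_eq_hatCLM, ← map_add, ← map_neg]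
    rfl
  have key := newF_algebra (r := Real.sqrt |deriv T k.1.1.1|) (e := ε) (e' := ε')
    (x := k.1.1.2) (S := deriv (deriv T) k.1.1.1) (Y := deriv X k.1.1.1) (b := k'.2.1.2)
    (a := k'.2.1.1) (h := k'.2.2.2.2) (wt := hat ε' k.2.1.1) (wx := hat ε' k.2.1.2)
    (wxx := hat ε' k.2.2.2.2) hr h.eps h.eps'
    (by simpa using h1) (by rw [← hT]; simpa using h2) (by simpa [mul_pow, hc] using h3)
  rw [← hA, ← hp] at key
  exact key

end IsParameterSystem

/-! ### The parameters of a transformation over a convex set -/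

theorem eq_of_fderiv_eq_zero {N : Set Base} (hc : Convex ℝ N) {g : Base → ℝ}
    (hg : ∀ z ∈ N, DifferentiableAt ℝ g z) {z z' : Base} (hz : z ∈ N) (hz' : z' ∈ N)
    (h0 : ∀ y ∈ N, fderiv ℝ g y (z' - z) = 0) : g z' = g z := by
  have hmem : ∀ s ∈ Icc (0 : ℝ) 1, z + s • (z' - z) ∈ N := fun s hs =>
    hc.add_smul_sub_mem hz hz' hs
  have hd : ∀ s ∈ Icc (0 : ℝ) 1, HasDerivAt (fun s : ℝ => g (z + s • (z' - z))) 0 s := by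
    intro s hs
    have h1 : HasDerivAt (fun s : ℝ => z + s • (z' - z)) (z' - z) s := by
      simpa using ((hasDerivAt_id s).smul_const (z' - z)).const_add z
    have h2 := HasFDerivAt.comp_hasDerivAt s (hg _ (hmem s hs)).hasFDerivAt h1
    rwa [h0 _ (hmem s hs)] at h2
  have h := constant_of_has_deriv_right_zero
    (fun s hs => (hd s hs).continuousAt.continuousWithinAt)
    (fun s hs => (hd s (Ico_subset_Icc_self hs)).hasDerivWithinAt) 1 (by simp)
  simpa using h

/-- A function on an open convex set whose derivative in the directions of `x` and `ψ` vanishes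
is a function of `t`. -/
theorem exists_function_of_time {N : Set Base} (hN : IsOpen N) (hc : Convex ℝ N) {g : Base → ℝ}
    (hg : ContDiffOn ℝ ∞ g N) (h0 : ∀ z ∈ N, ∀ (y : ℝ) (η : ℂ), fderiv ℝ g z ((0, y), η) = 0) :
    ∃ S : ℝ → ℝ, ContDiffOn ℝ ∞ S ((fun z : Base => z.1.1) '' N) ∧ ∀ z ∈ N, g z = S z.1.1 := by
  have hga (z : Base) (hz : z ∈ N) : ContDiffAt ℝ ∞ g z := hg.contDiffAt (hN.mem_nhds hz)
  have heq : ∀ z ∈ N, ∀ z' ∈ N, z.1.1 = z'.1.1 → g z = g z' := by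
    intro z hz z' hz' h
    refine eq_of_fderiv_eq_zero hc (fun y hy => (hga y hy).differentiableAt (by simp)) hz' hz
      fun y hy => ?_
    have e : z - z' = ((0, z.1.2 - z'.1.2), z.2 - z'.2) :=
      Prod.ext (Prod.ext (sub_eq_zero.mpr h) rfl) rfl
    rw [e, h0 y hy]
  classical
  -- The value `0` outside the projection of `N` is a default that is never evaluated on `N`.
  let S : ℝ → ℝ := fun t => if h : ∃ z ∈ N, z.1.1 = t then g h.choose else 0
  have hS : ∀ z ∈ N, g z = S z.1.1 := by
    intro z hz
    have hex : ∃ z' ∈ N, z'.1.1 = z.1.1 := ⟨z, hz, rfl⟩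
    have e : S z.1.1 = g hex.choose := dif_pos hex
    rw [e]
    exact heq z hz _ hex.choose_spec.1 hex.choose_spec.2.symm
  refine ⟨S, ?_, hS⟩
  rintro t ⟨z, hz, rfl⟩
  -- Near the given time, `S` is the restriction of `g` to the line through `z` with `x` and `ψ`
  -- frozen, which gives smoothness in spite of the choices made.
  have h1 : ContDiffAt ℝ ∞ (fun s : ℝ => (((s, z.1.2), z.2) : Base)) z.1.1 := by fun_prop
  have h2 : ContDiffAt ℝ ∞ (fun s : ℝ => g ((s, z.1.2), z.2)) z.1.1 :=
    ContDiffAt.comp z.1.1 (g := g) (hga z hz) h1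
  refine (h2.congr_of_eventuallyEq ?_).contDiffWithinAt
  filter_upwards [h1.continuousAt.eventually (hN.mem_nhds hz)] with s hs
  exact (hS _ hs).symm

/-- A continuous function without zeros on a preconnected set cannot change sign, by the
intermediate value theorem. -/
theorem exists_sign {N : Set Base} (hc : IsPreconnected N) {g : Base → ℝ} (hg : ContinuousOn g N)
    (h0 : ∀ z ∈ N, g z ≠ 0) : ∃ e : ℝ, (e = 1 ∨ e = -1) ∧ ∀ z ∈ N, 0 < e * g z := by
  by_cases h : ∀ z ∈ N, 0 < g z
  · exact ⟨1, Or.inl rfl, fun z hz => by rw [one_mul]; exact h z hz⟩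
  · push Not at h
    obtain ⟨z₀, hz₀, h₀⟩ := h
    refine ⟨-1, Or.inr rfl, fun z hz => ?_⟩
    by_contra hle
    have h1 : 0 ≤ g z := by linarith
    obtain ⟨y, hy, hy0⟩ := hc.intermediate_value hz₀ hz hg ⟨h₀, h1⟩
    exact h0 y hy hy0

/-- Convexity makes the slices of `N` at fixed `t` connected, so quantities with zero `x`- and
`ψ`-derivatives are single-valued functions of `t`. These are the new `t` and the new `x` minus `ε x
√|T_t|`; the fibre condition is the Cauchy–Riemann equation for `Φ`. -/
theorem IsReducedTransformation.exists_parameters {φ : OpenPartialHomeomorph Base Base}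
    (h : IsReducedTransformation φ) {N : Set Base} (hN : IsOpen N) (hc : Convex ℝ N)
    (hs : N ⊆ φ.source) : ∃ (T X : ℝ → ℝ) (ε ε' : ℝ) (Φ : ℝ → ℝ → ℂ → ℂ),
      IsParameterSystem N T X ε ε' Φ ∧ ∀ z ∈ N, φ z = newBase T X ε ε' Φ z := by
  have hφ (z : Base) (hz : z ∈ N) : ContDiffAt ℝ ∞ φ z := h.point.contDiffAt (hs hz)
  have hD (z : Base) (hz : z ∈ N) : HasFDerivAt φ (fderiv ℝ φ z) z :=
    ((hφ z hz).differentiableAt (by simp)).hasFDerivAt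
  have hcont (v : Base) : ContinuousOn (fun z => fderiv ℝ φ z v) N := fun z hz =>
    (contDiffAt_fderiv_apply (g := fun z => z) (hφ z hz) contDiffAt_id
      contDiffAt_const).continuousAt.continuousWithinAt
  obtain ⟨ε', hε', hsign'⟩ := exists_sign hc.isPreconnected
    (g := fun z => (fderiv ℝ φ z ((1, 0), 0)).1.1) (hcont _).fst.fst
    fun z hz => (h.reduced z (hs hz)).time_ne
  obtain ⟨ε, hε, hsign⟩ := exists_sign hc.isPreconnected
    (g := fun z => (fderiv ℝ φ z ((0, 1), 0)).1.2) (hcont _).fst.snd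
    fun z hz => (h.reduced z (hs hz)).space_ne
  obtain ⟨T, hT, hTφ⟩ := exists_function_of_time hN hc (g := fun z => (φ z).1.1)
    (fun z hz => (hφ z hz).fst.fst.contDiffWithinAt) (fun z hz y η => by
      rw [(hD z hz).fst.fst.fderiv]
      exact (h.reduced z (hs hz)).time y η)
  have hPopen := isOpen_image_time hN
  have p1 (z : Base) : HasFDerivAt (fun z : Base => z.1.1) ((ContinuousLinearMap.fst ℝ ℝ ℝ).comp
      (ContinuousLinearMap.fst ℝ (ℝ × ℝ) ℂ)) z :=
    ((ContinuousLinearMap.fst ℝ ℝ ℝ).comp (ContinuousLinearMap.fst ℝ (ℝ × ℝ) ℂ)).hasFDerivAt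
  have p2 (z : Base) : HasFDerivAt (fun z : Base => z.1.2) ((ContinuousLinearMap.snd ℝ ℝ ℝ).comp
      (ContinuousLinearMap.fst ℝ (ℝ × ℝ) ℂ)) z :=
    ((ContinuousLinearMap.snd ℝ ℝ ℝ).comp (ContinuousLinearMap.fst ℝ (ℝ × ℝ) ℂ)).hasFDerivAt
  have hTat (z : Base) (hz : z ∈ N) : ContDiffAt ℝ ∞ T z.1.1 :=
    hT.contDiffAt (hPopen.mem_nhds (mem_image_of_mem _ hz))
  have hTt : ∀ z ∈ N, deriv T z.1.1 = (fderiv ℝ φ z ((1, 0), 0)).1.1 := by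
    intro z hz
    have h1 := ((hTat z hz).differentiableAt (by simp)).hasDerivAt.comp_hasFDerivAt z (p1 z)
    have h2 : (fun z : Base => (φ z).1.1) =ᶠ[𝓝 z] T ∘ fun z : Base => z.1.1 := by
      filter_upwards [hN.mem_nhds hz] with y hy using hTφ y hy
    have h3 := DFunLike.congr_fun (h1.unique ((hD z hz).fst.fst.congr_of_eventuallyEq h2.symm))
      ((1, 0), 0)
    simpa using h3
  have hTne : ∀ z ∈ N, deriv T z.1.1 ≠ 0 := fun z hz => by
    rw [hTt z hz]; exact (h.reduced z (hs hz)).time_ne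
  have hroot (z : Base) (hz : z ∈ N) : ContDiffAt ℝ ∞ (fun s => Real.sqrt |deriv T s|) z.1.1 := by
    have h1 : ContDiffAt ℝ ∞ (deriv T) z.1.1 := (hTat z hz).derivWithin (m := ∞) le_rfl
    exact (h1.abs (hTne z hz)).sqrt (abs_ne_zero.mpr (hTne z hz))
  have hχ : ∀ z ∈ N, (fderiv ℝ φ z ((0, 1), 0)).1.2 = ε * Real.sqrt |deriv T z.1.1| := by
    intro z hz
    have h1 := (h.reduced z (hs hz)).scale
    have h2 := hsign z hz
    rw [← hTt z hz] at h1
    rw [← h1, Real.sqrt_sq_eq_abs]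
    rcases hε with rfl | rfl
    · rw [one_mul] at *
      exact (abs_of_pos h2).symm
    · rw [neg_one_mul] at *
      rw [abs_of_neg (neg_pos.mp h2), neg_neg]
  obtain ⟨X, hX, hXφ⟩ := exists_function_of_time hN hc
    (g := fun z => (φ z).1.2 - ε * z.1.2 * Real.sqrt |deriv T z.1.1|)
    (fun z hz => by
      have q1 : ContDiffAt ℝ ∞ (fun z : Base => z.1.1) z := by fun_prop
      have q2 : ContDiffAt ℝ ∞ (fun z : Base => z.1.2) z := by fun_prop
      exact ((hφ z hz).fst.snd.sub ((contDiffAt_const.mul q2).mul (ContDiffAt.comp z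
        (g := fun s => Real.sqrt |deriv T s|) (hroot z hz) q1))).contDiffWithinAt)
    (fun z hz y η => by
      have h1 := (((hroot z hz).differentiableAt (by simp)).hasDerivAt).comp_hasFDerivAt z (p1 z)
      have h2 := (hD z hz).fst.snd.sub (((p2 z).const_mul ε).mul h1)
      refine (DFunLike.congr_fun h2.fderiv ((0, y), η)).trans ?_
      have h3 := (h.reduced z (hs hz)).apply_space ((0, y), η)
      rw [hχ z hz] at h3
      simp only [sub_apply, ContinuousLinearMap.comp_apply, ContinuousLinearMap.coe_fst',
        ContinuousLinearMap.coe_snd', h3, add_apply, smul_apply, Function.comp_apply, smul_eq_mul]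
      ring)
  refine ⟨T, X, ε, ε', fun t x w => (φ ((t, x), hat ε' w)).2, ?_, fun z hz => ?_⟩
  · have hsnd : ∀ y ∈ hatSet ε' N, hatBase ε' y ∈ N := fun y hy => by
      rw [hatBase_apply]; exact hy
    have hderiv : ∀ y ∈ hatSet ε' N, HasFDerivAt (fun w => (φ (y.1, hat ε' w)).2)
        (((ContinuousLinearMap.snd ℝ (ℝ × ℝ) ℂ).comp (fderiv ℝ φ (hatBase ε' y))).comp
          ((ContinuousLinearMap.inr ℝ (ℝ × ℝ) ℂ).comp (hatCLM ε'))) y.2 := by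
      intro y hy
      have h1 : HasFDerivAt (fun w : ℂ => ((y.1, hatCLM ε' w) : Base))
          ((ContinuousLinearMap.inr ℝ (ℝ × ℝ) ℂ).comp (hatCLM ε')) y.2 :=
        (hasFDerivAt_prodMk_right y.1 (hatCLM ε' y.2)).comp y.2 (hatCLM ε').hasFDerivAt
      have h2 := HasFDerivAt.comp (g := fun z => (φ z).2) y.2 (hD _ (hsnd y hy)).snd h1
      simp only [hat_eq_hatCLM]
      exact h2
    have happly : ∀ y ∈ hatSet ε' N, ∀ v, fderiv ℝ (fun w => (φ (y.1, hat ε' w)).2) y.2 v =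
        (fderiv ℝ φ (hatBase ε' y) (0, hat ε' v)).2 := by
      intro y hy v
      rw [(hderiv y hy).fderiv, hat_eq_hatCLM]
      rfl
    have hhol : ∀ y ∈ hatSet ε' N, DifferentiableAt ℂ (fun w => (φ (y.1, hat ε' w)).2) y.2 := by
      intro y hy
      have hr := h.reduced _ (hs (hsnd y hy))
      refine differentiableAt_complex_iff_differentiableAt_real.mpr
        ⟨(hderiv y hy).differentiableAt, ?_⟩
      have e : (fderiv ℝ φ (hatBase ε' y) ((1, 0), 0)).1.1 /
          |(fderiv ℝ φ (hatBase ε' y) ((1, 0), 0)).1.1| = ε' := by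
        rw [div_eq_iff (abs_ne_zero.mpr hr.time_ne)]
        have := hsign' _ (hsnd y hy)
        rcases hε' with rfl | rfl
        · rw [one_mul] at *
          exact (abs_of_pos this).symm
        · rw [neg_one_mul] at *
          rw [abs_of_neg (neg_pos.mp this), neg_neg]
      have e1 : hat ε' Complex.I = ε' • (Complex.I * hat ε' 1) := by
        have := hat_I_mul hε' 1
        rwa [mul_one] at this
      -- Pulling `i` through the hat produces one factor `ε'` and pulling it through the
      -- differential another; they cancel, leaving the Cauchy–Riemann equation in `w`.
      rw [happly y hy, happly y hy, e1, clm_snd_smul, Prod.smul_snd, hr.conf, e, smul_smul]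
      have e2 : ε' * ε' = 1 := by rcases hε' with rfl | rfl <;> norm_num
      rw [e2, one_smul, smul_eq_mul]
    refine ⟨hε, hε', hT, hX, fun z hz => ?_, ?_, hhol, fun y hy h0 => ?_⟩
    · rw [hTt z hz]
      exact hsign' z hz
    · intro y hy
      have h1 : ContDiffAt ℝ ∞ (fun y => (φ (hatBase ε' y)).2) y :=
        (ContDiffAt.comp y (hφ _ (hsnd y hy)) (hatBase ε').contDiff.contDiffAt).snd
      simp only [hatBase_apply] at h1
      exact h1.contDiffWithinAt
    · have h1 := (hhol y hy).hasDerivAt.hasFDerivAt.restrictScalars ℝ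
      have h2 := DFunLike.congr_fun (h1.unique (hderiv y hy)) 1
      change deriv (fun w => (φ (y.1, hat ε' w)).2) y.2 = 0 at h0
      have h3 : (fderiv ℝ φ (hatBase ε' y) (0, hat ε' 1)).2 = 0 := by
        rw [← happly y hy, (hderiv y hy).fderiv, ← h2, h0]
        simp
      have h4 : fderiv ℝ φ (hatBase ε' y) (0, hat ε' 1) = fderiv ℝ φ (hatBase ε' y) 0 := by
        rw [(h.reduced _ (hs (hsnd y hy))).apply_vertical, h3, map_zero]
        rfl
      have h5 := congrArg Prod.snd (h.point.fderiv_injective (hs (hsnd y hy)) h4)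
      have h6 := hat_hat ε' 1
      rw [show hat ε' 1 = 0 from h5] at h6
      simp [hat] at h6
  · refine Prod.ext (Prod.ext (hTφ z hz) ?_) ?_
    · have := hXφ z hz
      change (φ z).1.2 = ε * z.1.2 * Real.sqrt |deriv T z.1.1| + X z.1.1
      rw [← this]
      ring
    · change (φ z).2 = (φ ((z.1.1, z.1.2), hat ε' (hat ε' z.2))).2
      rw [hat_hat]

section

variable {N : Set Base} {T X : ℝ → ℝ} {ε ε' : ℝ} {Φ : ℝ → ℝ → ℂ → ℂ}
  {φ : OpenPartialHomeomorph Base Base} {Ψ : OpenPartialHomeomorph (Jet × ℂ) (Jet × ℂ)}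

theorem IsParameterSystem.newF_eq_prolong (h : IsParameterSystem N T X ε ε' Φ) (hN : IsOpen N)
    (hφ : IsReducedTransformation φ) (hs : N ⊆ φ.source)
    (he : ∀ z ∈ N, φ z = newBase T X ε ε' Φ z) {q : Jet × ℂ} (hq : q.1.1 ∈ N) :
    newF T X ε ε' Φ q.1 q.2 = -(prolong φ (jetAt q.1.args q.2)).principal := by
  have h1 : φ =ᶠ[𝓝 q.1.1] newBase T X ε ε' Φ := by
    filter_upwards [hN.mem_nhds hq] with y hy using he y hy
  have h2 := h.newF_eq hN hφ (k := jetAt q.1.args q.2) hq h1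
    (hφ.prolongs_prolong (j := jetAt q.1.args q.2) (hs hq))
  rw [jetAt_principal, neg_neg] at h2
  exact h2

/-- Being reduced is a pointwise condition on the differential and the action on `F` is checked
point by point, so for the converse it suffices to use the formulas on balls. -/
theorem isEquivalenceTransformation_iff (hΨ : IsPointTransformation Ψ)
    (hφ : IsPointTransformation φ) (hr : RestrictsTo Ψ φ) :
    IsEquivalenceTransformation Ψ φ ↔
      ∀ N : Set Base, IsOpen N → Convex ℝ N → N ⊆ φ.source →
        ∃ (T X : ℝ → ℝ) (ε ε' : ℝ) (Φ : ℝ → ℝ → ℂ → ℂ),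
          IsParameterSystem N T X ε ε' Φ ∧ IsGivenBy Ψ φ N T X ε ε' Φ := by
  constructor
  · intro h N hN hc hs
    have hred := h.isReducedTransformation
    obtain ⟨T, X, ε, ε', Φ, hp, he⟩ := hred.exists_parameters hN hc hs
    refine ⟨T, X, ε, ε', Φ, hp, he, fun q hq hqN => ?_⟩
    rw [h.apply_snd hq, hp.newF_eq_prolong hN hred hs he hqN]
  · intro h
    have hball : ∀ z ∈ φ.source, ∃ N : Set Base, IsOpen N ∧ Convex ℝ N ∧ N ⊆ φ.source ∧
        z ∈ N := by
      intro z hz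
      obtain ⟨δ, hδ, hb⟩ := Metric.isOpen_iff.mp φ.open_source z hz
      exact ⟨Metric.ball z δ, Metric.isOpen_ball, convex_ball z δ, hb, Metric.mem_ball_self hδ⟩
    have hred : IsReducedTransformation φ := by
      refine ⟨hφ, fun z hz => ?_⟩
      obtain ⟨N, hN, hc, hs, hzN⟩ := hball z hz
      obtain ⟨T, X, ε, ε', Φ, hp, he, -⟩ := h N hN hc hs
      have e : φ =ᶠ[𝓝 z] newBase T X ε ε' Φ := by
        filter_upwards [hN.mem_nhds hzN] with y hy using he y hy
      rw [e.fderiv_eq]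
      exact hp.isReduced hN hzN
    refine hred.isEquivalenceTransformation hΨ hr fun q hq => ?_
    obtain ⟨N, hN, hc, hs, hqN⟩ := hball q.1.1 (hr.2.2 q hq).mem_source
    obtain ⟨T, X, ε, ε', Φ, hp, he, hF⟩ := h N hN hc hs
    rw [hF q hq hqN, hp.newF_eq_prolong hN hred hs he hqN]

theorem IsParameterSystem.exists_isGivenBy (h : IsParameterSystem N T X ε ε' Φ) (hN : IsOpen N)
    {z : Base} (hz : z ∈ N) :
    ∃ (Ψ : OpenPartialHomeomorph (Jet × ℂ) (Jet × ℂ)) (φ : OpenPartialHomeomorph Base Base),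
      z ∈ φ.source ∧ φ.source ⊆ N ∧ IsEquivalenceTransformation Ψ φ ∧
        IsGivenBy Ψ φ φ.source T X ε ε' Φ := by
  have hD : ∀ y ∈ N, ∃ A : Base ≃L[ℝ] Base,
      HasFDerivAt (newBase T X ε ε' Φ) (A : Base →L[ℝ] Base) y := by
    intro y hy
    have hinj := h.fderiv_newBase_injective hN hy
    refine ⟨(LinearEquiv.ofBijective (fderiv ℝ (newBase T X ε ε' Φ) y : Base →ₗ[ℝ] Base)
      ⟨hinj, LinearMap.injective_iff_surjective.mp hinj⟩).toContinuousLinearEquiv, ?_⟩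
    exact ((h.contDiffAt_newBase hN hy).differentiableAt (by simp)).hasFDerivAt
  obtain ⟨A, hA⟩ := hD z hz
  let e := (h.contDiffAt_newBase hN hz).toOpenPartialHomeomorph (newBase T X ε ε' Φ) hA (by simp)
  have hze : z ∈ e.source :=
    (h.contDiffAt_newBase hN hz).mem_toOpenPartialHomeomorph_source hA (by simp)
  let φ := e.restr N
  have hsource : φ.source = e.source ∩ N := e.restr_source' N hN
  have hsN : φ.source ⊆ N := by rw [hsource]; exact inter_subset_right
  have hφe : ∀ y, φ y = newBase T X ε ε' Φ y := fun _ => rfl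
  have hpoint : IsPointTransformation φ := by
    refine ⟨fun y hy => (h.contDiffAt_newBase hN (hsN hy)).contDiffWithinAt, fun y hy => ?_⟩
    have hy' := hsN (φ.map_target hy)
    obtain ⟨B, hB⟩ := hD _ hy'
    -- The differential is invertible at all points of `N`, so the inverse is smooth on the whole
    -- target and not only near the image of `z`.
    exact (φ.contDiffAt_symm hy hB (h.contDiffAt_newBase hN hy')).contDiffWithinAt
  have hred : IsReducedTransformation φ := ⟨hpoint, fun y hy => h.isReduced hN (hsN hy)⟩
  refine ⟨hred.equivalence, φ, by rw [hsource]; exact ⟨hze, hz⟩, hsN,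
    hred.isEquivalenceTransformation_equivalence, fun y _ => hφe y, fun q hq _ => ?_⟩
  have h1 : φ =ᶠ[𝓝 q.1.1] newBase T X ε ε' Φ := Filter.Eventually.of_forall hφe
  have h2 := h.newF_eq hN hred (k := jetAt q.1.args q.2) (hsN hq) h1
    (hred.prolongs_prolong (j := jetAt q.1.args q.2) hq)
  rw [jetAt_principal, neg_neg] at h2
  exact h2.symm

end

end SchrodingerClass

end

theorem mainTheorem1 :
    -- the class is strongly normalized
    SchrodingerClass.IsStronglyNormalized ∧
    -- the equivalence group consists exactly of the transformations of the explicit form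
    (∀ (Ψ : OpenPartialHomeomorph (SchrodingerClass.Jet × ℂ) (SchrodingerClass.Jet × ℂ))
        (φ : OpenPartialHomeomorph SchrodingerClass.Base SchrodingerClass.Base),
      SchrodingerClass.IsPointTransformation Ψ → SchrodingerClass.IsPointTransformation φ →
      SchrodingerClass.RestrictsTo Ψ φ →
      (SchrodingerClass.IsEquivalenceTransformation Ψ φ ↔
        ∀ N : Set SchrodingerClass.Base, IsOpen N → Convex ℝ N → N ⊆ φ.source →
          ∃ (T X : ℝ → ℝ) (ε ε' : ℝ) (Φ : ℝ → ℝ → ℂ → ℂ),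
            SchrodingerClass.IsParameterSystem N T X ε ε' Φ ∧
            SchrodingerClass.IsGivenBy Ψ φ N T X ε ε' Φ)) ∧
    -- all values of the parameters occur
    (∀ (N : Set SchrodingerClass.Base) (T X : ℝ → ℝ) (ε ε' : ℝ) (Φ : ℝ → ℝ → ℂ → ℂ),
      IsOpen N → SchrodingerClass.IsParameterSystem N T X ε ε' Φ → ∀ z ∈ N,
        ∃ (Ψ : OpenPartialHomeomorph (SchrodingerClass.Jet × ℂ) (SchrodingerClass.Jet × ℂ))
          (φ : OpenPartialHomeomorph SchrodingerClass.Base SchrodingerClass.Base),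
          z ∈ φ.source ∧ φ.source ⊆ N ∧ SchrodingerClass.IsEquivalenceTransformation Ψ φ ∧
          SchrodingerClass.IsGivenBy Ψ φ φ.source T X ε ε' Φ) := by
  exact ⟨SchrodingerClass.isStronglyNormalized,
    fun _ _ hΨ hφ hr => SchrodingerClass.isEquivalenceTransformation_iff hΨ hφ hr,
    fun _ _ _ _ _ _ hN h _ hz => h.exists_isGivenBy hN hz⟩
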